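/- **Theorem (Symmetric Pearcey kernel).** Fix $\alpha>0$ and set $\phi_\alpha(x)=\bigl(1+\alpha(1-x)+\tfrac{\alpha^2}{2}(1-x)\bigr)^{-1}$. For $a=\pm\tfrac12$ and $s\in\{0,1,2,\dots\}$ let $\mathsf J^{(a,-1/2)}_s$ be the polynomials determined by $$\mathsf J^{(1/2,-1/2)}_s\Bigl(\tfrac{z+z^{-1}}2\Bigr)=\frac{z^{s+1/2}-z^{-s-1/2}}{z^{1/2}-z^{-1/2}},\qquad \mathsf J^{(-1/2,-1/2)}_s\Bigl(\tfrac{z+z^{-1}}2\Bigr)=\frac{z^{s}+z^{-s}}{2},$$ and let $W^{(a,-1/2)}(s)=2$ if $a=-\tfrac12$ and $s>0$, and $W^{(a,-1/2)}(s)=1$ otherwise. For integers $n,r_1,r_2,s_1,s_2\ge 0$ and $a_1,a_2\in\{\pm\tfrac12\}$ define $$\begin{aligned}K_n(r_1,a_1,s_1;r_2,a_2,s_2)={}&1_{2r_1+a_1\ge 2r_2+a_2}\frac{W^{(a_1,-1/2)}(s_1)}{\pi}\int_{-1}^1\mathsf J^{(a_1,-1/2)}_{s_1}(x)\,\mathsf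 J^{(a_2,-1/2)}_{s_2}(x)\,(x-1)^{r_1-r_2}(1-x)^{a_1}(1+x)^{-1/2}\,dx\\&+\frac{W^{(a_1,-1/2)}(s_1)}{\pi}\,\frac1{2\pi i}\int_{-1}^1\oint_C\frac{\phi_\alpha(x)^n}{\phi_\alpha(u)^n}\,\mathsf J^{(a_1,-1/2)}_{s_1}(x)\,\mathsf J^{(a_2,-1/2)}_{s_2}(u)\,\frac{(x-1)^{r_1}}{(u-1)^{r_2}}\,\frac{(1-x)^{a_1}(1+x)^{-1/2}}{x-u}\,du\,dx,\end{aligned}$$ where $C$ is a positively oriented simple loop around $[-1,1]$. Define the symmetric Pearcey kernel by $$\begin{aligned}\mathcal K(\sigma_1,\eta_1,\sigma_2,\eta_2)={}&\frac{2}{\pi^2 i}\int\!\int_0^\infty e^{-\eta_1x^2+\eta_2u^2+u^4-x^4}\cos(\sigma_1x)\cos(\sigma_2u)\frac{u}{u^2-x^2}\,dx\,du\\&-\frac{1_{\eta_2<\eta_1}}{2\sqrt{\pi(\eta_1-\eta_2)}}\Bigl(e^{\frac{(\sigma_1+\sigma_2)^2}{4(\eta_2-\eta_1)}}+e^{\frac{(\sigma_1-\sigma_2)^2}{4(\eta_2-\eta_1)}}\Bigr),\end{aligned}$$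 the $u$-contour being the rays from $\infty e^{i\pi/4}$ to $0$ to $\infty e^{-i\pi/4}$. Put $c_\alpha=(1+\alpha)(\alpha(2+\alpha))^{-1/4}$. Let $\sigma_1,\sigma_2>0$, $\eta_1,\eta_2\in\mathbb R$, fix $a_1,a_2\in\{\pm\frac12\}$, and let the nonnegative integers $n,r_1,r_2,s_1,s_2$ depend on $N=0,1,2,\dots$ so that, as $N\to\infty$, for $j=1,2$, $$\frac nN\to1,\qquad \frac{r_j-(1-(1+\alpha)^{-2})\,n}{\sqrt N}\to 2^{-1/2}\,\eta_j\,c_\alpha^{-2},\qquad \frac{s_j}{N^{1/4}}\to 2^{-5/4}\,\sigma_j\,c_\alpha^{-1}.$$ Assume that $(\sigma_1,\eta_1)\ne(\sigma_2,\eta_2)$, or that $2r_1+a_1\le 2r_2+a_2$ for all large $N$ (for instance, both points on the same level). Then $$(-2)^{r_2-r_1}(-1)^{s_1-s_2}\frac{N^{1/4}}{c_\alpha2^{5/4}}\Bigl(1_{(r_1,a_1,s_1)=(r_2,a_2,s_2)}-K_n(r_1,a_1,s_1;r_2,a_2,s_2)\Bigr)\longrightarrow\mathcal K(\sigma_1,\eta_1,\sigma_2,\eta_2).$$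 In particular, if $(\sigma_1,\eta_1)\neq(\sigma_2,\eta_2)$, the indicator vanishes for all large $N$, and the rescaled $K_n$ converges to $-\mathcal K$. -/

import Mathlib

open Filter Topology

noncomputable section

namespace SymmetricPearcey

/-- The two admissible values of the parameter `a`: `plus` is `1/2` and `minus` is `-1/2`. -/
inductive HalfSign : Type
  | plus : HalfSign
  | minus : HalfSign
  deriving DecidableEq

/-- The real number `a = ±1/2`. -/
def HalfSign.val : HalfSign → ℝ
  | .plus => 1 / 2
  | .minus => -(1 / 2)

/-- The normalized Jacobi polynomials `J_s^{(a,-1/2)}` for `a = ±1/2`, in terms of the Chebyshev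
polynomials: `T_s` for `a = -1/2` and `U_s + U_{s-1}` for `a = 1/2`. They are the polynomials with
`J_s^{(-1/2,-1/2)}((z+z⁻¹)/2) = (z^s+z^{-s})/2` and
`J_s^{(1/2,-1/2)}((z+z⁻¹)/2) = (z^{s+1/2}-z^{-s-1/2})/(z^{1/2}-z^{-1/2})`;
see `jacobi_minus_eval` and `jacobi_plus_eval`. -/
def jacobi : HalfSign → ℕ → Polynomial ℂ
  | .minus, s => Polynomial.Chebyshev.T ℂ (s : ℤ)
  | .plus, s => Polynomial.Chebyshev.U ℂ (s : ℤ) + Polynomial.Chebyshev.U ℂ ((s : ℤ) - 1)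

theorem jacobi_minus_eval (s : ℕ) (z : ℂ) (hz : z ≠ 0) :
    (jacobi .minus s).eval ((z + z⁻¹) / 2) = (z ^ s + (z⁻¹) ^ s) / 2 := by
  have key : ∀ s : ℕ,
      (Polynomial.Chebyshev.T ℂ (s : ℤ)).eval ((z + z⁻¹) / 2) = (z ^ s + (z⁻¹) ^ s) / 2 ∧
      (Polynomial.Chebyshev.T ℂ ((s : ℤ) + 1)).eval ((z + z⁻¹) / 2) =
        (z ^ (s + 1) + (z⁻¹) ^ (s + 1)) / 2 := by
    intro s
    induction s with
    | zero => simp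
    | succ k ih =>
      obtain ⟨h0, h1⟩ := ih
      refine ⟨by exact_mod_cast h1, ?_⟩
      have e : ((k + 1 : ℕ) : ℤ) + 1 = (k : ℤ) + 2 := by push_cast; ring
      rw [e, Polynomial.Chebyshev.T_add_two]
      simp only [Polynomial.eval_sub, Polynomial.eval_mul, Polynomial.eval_X,
        Polynomial.eval_ofNat, h0, h1]
      linear_combination ((z ^ k + (z⁻¹) ^ k) / 2) * mul_inv_cancel₀ hz
  exact (key s).1

/-- Here `w` is a square root of `z`. -/
theorem jacobi_plus_eval (s : ℕ) (w : ℂ) (hw : w ≠ 0) (hw' : w - w⁻¹ ≠ 0) :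
    (jacobi .plus s).eval ((w ^ 2 + (w ^ 2)⁻¹) / 2) =
      (w ^ (2 * s + 1) - (w⁻¹) ^ (2 * s + 1)) / (w - w⁻¹) := by
  have key : ∀ s : ℕ,
      (jacobi .plus s).eval ((w ^ 2 + (w ^ 2)⁻¹) / 2) * (w - w⁻¹) =
        w ^ (2 * s + 1) - (w⁻¹) ^ (2 * s + 1) ∧
      (jacobi .plus (s + 1)).eval ((w ^ 2 + (w ^ 2)⁻¹) / 2) * (w - w⁻¹) =
        w ^ (2 * (s + 1) + 1) - (w⁻¹) ^ (2 * (s + 1) + 1) := by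
    intro s
    induction s with
    | zero =>
      constructor
      · simp [jacobi]
      · simp [jacobi]
        field_simp
        ring
    | succ k ih =>
      obtain ⟨h0, h1⟩ := ih
      refine ⟨h1, ?_⟩
      have e : jacobi .plus (k + 1 + 1) =
          2 * Polynomial.X * jacobi .plus (k + 1) - jacobi .plus k := by
        have e1 : ((k + 1 + 1 : ℕ) : ℤ) = (k : ℤ) + 2 := by push_cast; ring
        have e2 : (k : ℤ) + 2 - 1 = ((k : ℤ) - 1) + 2 := by ring
        have e3 : ((k + 1 : ℕ) : ℤ) = (k : ℤ) + 1 := by push_cast; ring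
        have e4 : (k : ℤ) + 1 - 1 = ((k : ℤ) - 1) + 1 := by ring
        simp only [jacobi, e1, e2, e3, e4, Polynomial.Chebyshev.U_add_two]
        ring
      rw [e]
      simp only [Polynomial.eval_sub, Polynomial.eval_mul, Polynomial.eval_X,
        Polynomial.eval_ofNat]
      rw [sub_mul, mul_assoc, h0, h1, ← inv_pow]
      linear_combination ((w ^ (2 * k + 1) - (w⁻¹) ^ (2 * k + 1)) * (w * w⁻¹ + 1)) *
        mul_inv_cancel₀ hw
  rw [eq_div_iff hw']
  exact (key s).1

/-- `W^{(a,-1/2)}(s)`. -/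
def W : HalfSign → ℕ → ℂ
  | .plus, _ => 1
  | .minus, s => if 0 < s then 2 else 1

/-- `φ_α(z) = (1 + α(1-z) + α²(1-z)/2)⁻¹`. -/
def phi (α : ℝ) (z : ℂ) : ℂ :=
  (1 + (α : ℂ) * (1 - z) + (α : ℂ) ^ 2 * (1 - z) / 2)⁻¹

/-- The weight `(1-x)^a (1+x)^{-1/2}`. -/
def weight (a : HalfSign) (x : ℝ) : ℂ :=
  (((1 - x) ^ a.val * (1 + x) ^ (-(1 / 2) : ℝ) : ℝ) : ℂ)

/-- The correlation kernel `K(r₁,a₁,s₁;r₂,a₂,s₂)` at time `n`. The `u`-integral is over a positively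
oriented loop around `[-1,1]`; all such loops give the same value, because in `u` the integrand is a
rational function whose only poles are `x` and `1`. The loop `|u| = 2` is used. -/
def kernelK (α : ℝ) (n : ℕ) (r₁ : ℕ) (a₁ : HalfSign) (s₁ : ℕ) (r₂ : ℕ) (a₂ : HalfSign) (s₂ : ℕ) :
    ℂ :=
  (if 2 * (r₁ : ℝ) + a₁.val ≥ 2 * (r₂ : ℝ) + a₂.val then
    W a₁ s₁ / (Real.pi : ℂ) *
      ∫ x in (-1 : ℝ)..1, (jacobi a₁ s₁).eval (x : ℂ) * (jacobi a₂ s₂).eval (x : ℂ) *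
        ((x : ℂ) - 1) ^ ((r₁ : ℤ) - (r₂ : ℤ)) * weight a₁ x
  else 0) +
  W a₁ s₁ / (Real.pi : ℂ) * (1 / (2 * (Real.pi : ℂ) * Complex.I)) *
    ∫ x in (-1 : ℝ)..1, ∮ u in C(0, 2),
      phi α (x : ℂ) ^ n / phi α u ^ n *
        (jacobi a₁ s₁).eval (x : ℂ) * (jacobi a₂ s₂).eval u *
        (((x : ℂ) - 1) ^ r₁ / (u - 1) ^ r₂) * (weight a₁ x / ((x : ℂ) - u))

/-- The integrand of the double integral in the symmetric Pearcey kernel. -/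
def pearceyIntegrand (σ₁ η₁ σ₂ η₂ : ℝ) (x : ℝ) (u : ℂ) : ℂ :=
  Complex.exp (-(η₁ : ℂ) * (x : ℂ) ^ 2 + (η₂ : ℂ) * u ^ 2 + u ^ 4 - (x : ℂ) ^ 4) *
    Complex.cos ((σ₁ : ℂ) * (x : ℂ)) * Complex.cos ((σ₂ : ℂ) * u) * (u / (u ^ 2 - (x : ℂ) ^ 2))

/-- `∫ f(u) du` along the rays from `∞ e^{iπ/4}` to `0` to `∞ e^{-iπ/4}`. -/
def rayIntegral (f : ℂ → ℂ) : ℂ :=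
  (∫ t in Set.Ioi (0 : ℝ), f ((t : ℂ) * Complex.exp (-((Real.pi : ℂ) / 4 * Complex.I))) *
      Complex.exp (-((Real.pi : ℂ) / 4 * Complex.I))) -
  ∫ t in Set.Ioi (0 : ℝ), f ((t : ℂ) * Complex.exp ((Real.pi : ℂ) / 4 * Complex.I)) *
      Complex.exp ((Real.pi : ℂ) / 4 * Complex.I)

/-- The symmetric Pearcey kernel `𝒦(σ₁,η₁,σ₂,η₂)`. -/
def pearceyKernel (σ₁ η₁ σ₂ η₂ : ℝ) : ℂ :=
  2 / ((Real.pi : ℂ) ^ 2 * Complex.I) *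
    rayIntegral (fun u => ∫ x in Set.Ioi (0 : ℝ), pearceyIntegrand σ₁ η₁ σ₂ η₂ x u) -
  (if η₂ < η₁ then
    ((1 / (2 * Real.sqrt (Real.pi * (η₁ - η₂))) *
      (Real.exp ((σ₁ + σ₂) ^ 2 / (4 * (η₂ - η₁))) +
        Real.exp ((σ₁ - σ₂) ^ 2 / (4 * (η₂ - η₁)))) : ℝ) : ℂ)
  else 0)

/-- `c_α = (1+α)(α(2+α))^{-1/4}`. -/
def cAlpha (α : ℝ) : ℝ := (1 + α) * (α * (2 + α)) ^ (-(1 / 4) : ℝ)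

end SymmetricPearcey

end

noncomputable section

namespace SymmetricPearcey

open MeasureTheory Set

/-! The kernel concentrates at the endpoint `x = u = -1`. Put `ρ = 1 - (1+α)⁻²` and `h = (1+x)/2`.
Up to constants, `φ_α(x)^n (x-1)^r` equals `(1-h)^r / (1-ρh)^n`, whose logarithm is `-(r-ρn)h -
(r-ρ²n)h²/2` plus terms of order `n h³`. As `r - ρn` is only of order `√N`, both displayed terms are
of order one when `h` is of order `N^(-1/2)`. With the mesh `l = c_α 2^(5/4) N^(-1/4)` and `x =
-cos(lξ)`, one has `h = sin²(lξ/2) ≈ l²ξ²/4`, and the factor tends to `exp(-ηξ² - ξ⁴)`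
(`IsScaling.tendsto_pow_div_pow`).

The reciprocal factor occurs in `u`. The loop is moved to `|u-1| = 2`, which passes through `-1` and
on which `|u-1|^r` is constant. There `(1+u)/2 = 1 - e^{∓iψ}`, and `ψ = l²t²/4` turns the two half
circles into the rays `t e^{±iπ/4}` in the limit, along which `u⁴ = -t⁴` decays. In the half angle
both polynomial families become cosines of frequency `2s + a + 1/2`, which gives `cos(σ₁x)` and
`cos(σ₂u)`.

The moved circle touches the end of the `x`-interval, so the Cauchy factor is singular at `ξ = t =
0`. It is bounded there by a multiple of `(ξt)^(-1/2)` (`norm_cauchy_factor_le`), which is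
integrable against the exponential bounds `IsScaling.lineFactor_le` and `IsScaling.circleFactor_le`.
Dominated convergence gives `tendsto_double_integral`.

The single integral reduces to integrals of `cos(qz) cos^m z` over `[0, π/2]`, with `m` the
difference of levels and `q` the sum or difference of the two frequencies. For `m = 0`,
orthogonality makes it cancel the indicator exactly. For `m` of order `√N` it has a Gaussian limit,
the second term of the Pearcey kernel. For positive `m = o(√N)`, integration by parts shows that it
is negligible if the frequencies separate (`abs_cosIntegral_le`). This last case is where distinct
limit points or an ordering of the levels is required. -/

/-! ### Polynomials and weight in the half angle -/

/-- The integer `a + 1/2`. -/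
def HalfSign.shift : HalfSign → ℕ
  | .plus => 1
  | .minus => 0

theorem HalfSign.val_eq (a : HalfSign) : a.val = a.shift - 1 / 2 := by
  cases a <;> norm_num [HalfSign.val, HalfSign.shift]

theorem HalfSign.shift_le_one (a : HalfSign) : a.shift ≤ 1 := by
  cases a <;> simp [HalfSign.shift]

theorem HalfSign.shift_injective : Function.Injective HalfSign.shift := by
  intro a b h
  cases a <;> cases b <;> simp_all [HalfSign.shift]

/-- The common form of both families of polynomials at `-(w² + w⁻²)/2`. -/
theorem jacobi_eval_neg (a : HalfSign) (s : ℕ) (w : ℂ) (hw : w ≠ 0) (hw' : w + w⁻¹ ≠ 0) :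
    (jacobi a s).eval (-(w ^ 2 + (w⁻¹) ^ 2) / 2) =
      (-1) ^ s * ((w ^ (2 * s + a.shift) + (w⁻¹) ^ (2 * s + a.shift)) / 2) /
        ((w + w⁻¹) / 2) ^ a.shift := by
  have hI : Complex.I ^ 2 = -1 := Complex.I_sq
  cases a with
  | minus =>
    have h := jacobi_minus_eval s (-w ^ 2) (by simpa using hw)
    have e1 : (-w ^ 2 + (-w ^ 2)⁻¹) / 2 = -(w ^ 2 + (w⁻¹) ^ 2) / 2 := by
      rw [inv_neg, inv_pow]; ring
    rw [e1] at h
    rw [h, HalfSign.shift]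
    have e2 : (-w ^ 2)⁻¹ = -(w⁻¹) ^ 2 := by rw [inv_neg, inv_pow]
    rw [e2, neg_pow, neg_pow ((w⁻¹) ^ 2), ← pow_mul, ← pow_mul]
    simp
    ring
  | plus =>
    -- `jacobi_plus_eval` takes a square root of `z`; for `z = -w²` this is `iw`, which turns the
    -- difference quotient into a quotient of sums.
    have hinv : (Complex.I * w)⁻¹ = -(Complex.I * w⁻¹) := by
      rw [mul_inv, Complex.inv_I]; ring
    have hd : Complex.I * w - (Complex.I * w)⁻¹ = Complex.I * (w + w⁻¹) := by
      rw [hinv]; ring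
    have h := jacobi_plus_eval s (Complex.I * w) (mul_ne_zero Complex.I_ne_zero hw)
      (by rw [hd]; exact mul_ne_zero Complex.I_ne_zero hw')
    have e1 : ((Complex.I * w) ^ 2 + ((Complex.I * w) ^ 2)⁻¹) / 2 =
        -(w ^ 2 + (w⁻¹) ^ 2) / 2 := by
      rw [mul_pow, hI, mul_inv, inv_pow]; norm_num; ring
    rw [e1, hd, hinv] at h
    rw [h, HalfSign.shift]
    have e3 : (-(Complex.I * w⁻¹)) ^ (2 * s + 1) =
        -(Complex.I * (-1) ^ s * (w⁻¹) ^ (2 * s + 1)) := by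
      rw [Odd.neg_pow ⟨s, rfl⟩, mul_pow, pow_succ Complex.I, pow_mul, hI]; ring
    have e4 : (Complex.I * w) ^ (2 * s + 1) = Complex.I * (-1) ^ s * w ^ (2 * s + 1) := by
      rw [mul_pow, pow_succ Complex.I, pow_mul, hI]; ring
    rw [e3, e4]
    field_simp [Complex.I_ne_zero]
    ring

/-- The sign in `-cos y` puts the critical endpoint `x = -1` at `y = 0`. The half angle lets one
formula serve both values of `a`. -/
theorem jacobi_eval_neg_cos (a : HalfSign) (s : ℕ) (y : ℝ) (hy : Real.cos (y / 2) ≠ 0) :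
    (jacobi a s).eval ((-Real.cos y : ℝ) : ℂ) =
      (-1) ^ s * (Real.cos ((2 * s + a.shift : ℕ) * (y / 2)) : ℂ) /
        (Real.cos (y / 2) : ℂ) ^ a.shift := by
  set w := Complex.exp ((y / 2 : ℝ) * Complex.I) with hw
  have hwi : w⁻¹ = Complex.exp (-((y / 2 : ℝ) * Complex.I)) := by rw [Complex.exp_neg]
  have hpow : ∀ k : ℕ, (w ^ k + (w⁻¹) ^ k) / 2 = (Real.cos (k * (y / 2)) : ℂ) := by
    intro k
    rw [hwi, hw, ← Complex.exp_nat_mul, ← Complex.exp_nat_mul, Complex.ofReal_cos, Complex.cos]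
    push_cast
    ring_nf
  have h1 := hpow 1
  have h2 := hpow 2
  simp only [pow_one, Nat.cast_one, one_mul] at h1
  have hne : w + w⁻¹ ≠ 0 := by
    intro h0
    rw [h0, zero_div] at h1
    exact hy (by exact_mod_cast h1.symm)
  have h := jacobi_eval_neg a s w (Complex.exp_ne_zero _) hne
  rw [hpow, h1, neg_div, h2] at h
  rw [← h]
  congr 1
  push_cast
  congr 2
  ring

/-- The points of the circle `|u - 1| = 2` are `1 - 2 E` with `|E| = 1`. -/
theorem jacobi_eval_one_sub (a : HalfSign) (s : ℕ) (E S : ℂ) (hE : E ≠ 0) (hS : S ^ 2 = 1 - E ^ 2) :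
    (jacobi a s).eval (1 - 2 * E ^ 2) =
      (-1) ^ s * (((E + Complex.I * S) ^ (2 * s + a.shift) +
        (E - Complex.I * S) ^ (2 * s + a.shift)) / 2) / E ^ a.shift := by
  have hmul : (E + Complex.I * S) * (E - Complex.I * S) = 1 := by
    linear_combination hS - S ^ 2 * Complex.I_sq
  have hne : E + Complex.I * S ≠ 0 := left_ne_zero_of_mul_eq_one hmul
  have hinv : (E + Complex.I * S)⁻¹ = E - Complex.I * S := inv_eq_of_mul_eq_one_right hmul
  have h := jacobi_eval_neg a s (E + Complex.I * S) hne (by rw [hinv]; ring_nf; simpa using hE)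
  rw [hinv] at h
  have e1 : -((E + Complex.I * S) ^ 2 + (E - Complex.I * S) ^ 2) / 2 = 1 - 2 * E ^ 2 := by
    linear_combination hS - S ^ 2 * Complex.I_sq
  have e2 : (E + Complex.I * S + (E - Complex.I * S)) / 2 = E := by ring
  rwa [e1, e2] at h

/-- With `1 - x = 2cos²(y/2)` and `1 + x = 2sin²(y/2)`, the Jacobian `sin y = 2 sin(y/2) cos(y/2)`
removes both endpoint singularities. -/
theorem weight_neg_cos_mul_sin (a : HalfSign) (y : ℝ) (hy : y ∈ Ioo 0 Real.pi) :
    weight a (-Real.cos y) * (Real.sin y : ℂ) = ((2 * Real.cos (y / 2) ^ 2 : ℝ) : ℂ) ^ a.shift := by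
  have hs : 0 < Real.sin (y / 2) :=
      Real.sin_pos_of_pos_of_lt_pi (by linarith [hy.1]) (by linarith [hy.1, hy.2])
  have hc : 0 < Real.cos (y / 2) :=
      Real.cos_pos_of_mem_Ioo ⟨by linarith [hy.1, Real.pi_pos], by linarith [hy.2]⟩
  have h1 : 1 - -Real.cos y = 2 * Real.cos (y / 2) ^ 2 := by
    rw [Real.cos_sq]; ring_nf
  have h2 : 1 + -Real.cos y = 2 * Real.sin (y / 2) ^ 2 := by
    rw [Real.sin_sq, Real.cos_sq]; ring_nf
  have h3 : Real.sin y = 2 * Real.sin (y / 2) * Real.cos (y / 2) := by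
    rw [← Real.sin_two_mul]; ring_nf
  have hS : (2 * Real.sin (y / 2) ^ 2) ^ (-(1 / 2) : ℝ) =
      (Real.sqrt 2)⁻¹ * (Real.sin (y / 2))⁻¹ := by
    rw [Real.rpow_neg (by positivity), ← Real.sqrt_eq_rpow, Real.sqrt_mul (by positivity),
      Real.sqrt_sq hs.le, mul_inv]
  have hC : Real.sqrt (2 * Real.cos (y / 2) ^ 2) = Real.sqrt 2 * Real.cos (y / 2) := by
    rw [Real.sqrt_mul (by positivity), Real.sqrt_sq hc.le]
  have h22 : Real.sqrt 2 * Real.sqrt 2 = 2 := Real.mul_self_sqrt (by norm_num)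
  have hq : Real.sqrt 2 ≠ 0 := by positivity
  rw [weight, h1, h2, hS, h3]
  cases a with
  | plus =>
    simp only [HalfSign.val, HalfSign.shift, ← Real.sqrt_eq_rpow, hC, pow_one]
    norm_cast
    field_simp
  | minus =>
    simp only [HalfSign.val, HalfSign.shift, pow_zero]
    rw [Real.rpow_neg (by positivity), ← Real.sqrt_eq_rpow, hC]
    norm_cast
    field_simp
    nlinarith

/-- The substitution `x = -cos (l ξ)`. -/
theorem integral_mul_weight (a : HalfSign) (l : ℝ) (hl : 0 < l) (G : ℝ → ℂ) :
    ∫ x in (-1 : ℝ)..1, G x * weight a x =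
      l * ∫ ξ in Ioo 0 (Real.pi / l), G (-Real.cos (l * ξ)) *
        ((2 * Real.cos (l * ξ / 2) ^ 2 : ℝ) : ℂ) ^ a.shift := by
  have hmem : ∀ ξ ∈ Ioo 0 (Real.pi / l), l * ξ ∈ Ioo 0 Real.pi := by
    intro ξ hξ
    refine ⟨mul_pos hl hξ.1, ?_⟩
    have := (lt_div_iff₀ hl).1 hξ.2
    linarith
  have himg : (fun ξ => -Real.cos (l * ξ)) '' Ioo 0 (Real.pi / l) = Ioo (-1) 1 := by
    ext x
    constructor
    · rintro ⟨ξ, hξ, rfl⟩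
      have h := hmem ξ hξ
      have h1 := Real.cos_lt_cos_of_nonneg_of_le_pi le_rfl h.2.le h.1
      have h2 := Real.cos_lt_cos_of_nonneg_of_le_pi h.1.le le_rfl h.2
      rw [Real.cos_zero] at h1
      rw [Real.cos_pi] at h2
      constructor <;> dsimp only <;> linarith
    · rintro ⟨h1, h2⟩
      refine ⟨Real.arccos (-x) / l, ⟨div_pos (Real.arccos_pos.2 (by linarith)) hl, ?_⟩, ?_⟩
      · have : Real.arccos (-x) ≠ Real.pi := fun h => by
          rw [Real.arccos_eq_pi] at h; linarith
        exact div_lt_div_of_pos_right (lt_of_le_of_ne (Real.arccos_le_pi _) this) hl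
      · dsimp only
        rw [mul_div_cancel₀ _ hl.ne', Real.cos_arccos (by linarith) (by linarith), neg_neg]
  have hinj : InjOn (fun ξ => -Real.cos (l * ξ)) (Ioo 0 (Real.pi / l)) := by
    intro ξ hξ ξ' hξ' h
    have h1 := hmem ξ hξ
    have h2 := hmem ξ' hξ'
    have := Real.injOn_cos ⟨h1.1.le, h1.2.le⟩ ⟨h2.1.le, h2.2.le⟩ (neg_injective h)
    exact mul_left_cancel₀ hl.ne' this
  have hder : ∀ ξ ∈ Ioo 0 (Real.pi / l),
      HasDerivWithinAt (fun ξ => -Real.cos (l * ξ)) (l * Real.sin (l *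
          ξ)) (Ioo 0 (Real.pi / l)) ξ := by
    intro ξ _
    have := (((hasDerivAt_id ξ).const_mul l).cos).neg
    refine (this.congr_deriv ?_).hasDerivWithinAt
    simp; ring
  rw [intervalIntegral.integral_of_le (by norm_num), integral_Ioc_eq_integral_Ioo, ← himg,
    integral_image_eq_integral_abs_deriv_smul measurableSet_Ioo hder hinj, ← integral_const_mul]
  refine setIntegral_congr_fun measurableSet_Ioo fun ξ hξ => ?_
  have h := hmem ξ hξ
  have hs := Real.sin_pos_of_pos_of_lt_pi h.1 h.2
  rw [abs_of_pos (mul_pos hl hs), ← weight_neg_cos_mul_sin a _ h, Complex.real_smul]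
  push_cast
  ring

/-! ### Moving the contour of a rational integrand -/

theorem continuousOn_sphere_inv_sub {c x : ℂ} {R : ℝ} (hx : x ∈ Metric.ball c R) :
    ContinuousOn (fun u : ℂ => (u - x)⁻¹) (Metric.sphere c R) := by
  refine (continuousOn_id.sub continuousOn_const).inv₀ fun u hu h => ?_
  have : u = x := sub_eq_zero.1 h
  rw [this] at hu
  exact (Metric.mem_ball.1 hx).ne (Metric.mem_sphere.1 hu)

theorem continuousOn_sphere_rational {c x : ℂ} {R : ℝ} (Q : Polynomial ℂ) (r : ℕ)
    (h1 : (1 : ℂ) ∈ Metric.ball c R) (hx : x ∈ Metric.ball c R) :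
    ContinuousOn (fun u : ℂ => Q.eval u * ((u - 1)⁻¹) ^ r * (u - x)⁻¹) (Metric.sphere c R) :=
  (Q.continuous.continuousOn.mul ((continuousOn_sphere_inv_sub h1).pow r)).mul
    (continuousOn_sphere_inv_sub hx)

theorem circleIntegral_polynomial (Q : Polynomial ℂ) (c : ℂ) (R : ℝ) (hR : 0 ≤ R) :
    ∮ u in C(c, R), Q.eval u = 0 :=
  Complex.circleIntegral_eq_zero_of_differentiable_on_off_countable hR countable_empty
    Q.continuous.continuousOn fun _ _ => Q.differentiable.differentiableAt

/-- The integral of a rational function with poles `1` and `x` only is the same over all circles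
around these two points. -/
theorem exists_circleIntegral_rational_eq (x : ℂ) (hx1 : x ≠ 1) (r : ℕ) (Q : Polynomial ℂ) :
    ∃ V : ℂ, ∀ (c : ℂ) (R : ℝ), 1 ∈ Metric.ball c R → x ∈ Metric.ball c R →
      ∮ u in C(c, R), Q.eval u * ((u - 1)⁻¹) ^ r * (u - x)⁻¹ = V := by
  have hsub : ∀ {c y u : ℂ} {R : ℝ}, y ∈ Metric.ball c R → u ∈ Metric.sphere c R → u - y ≠ 0 := by
    intro c y u R hy hu h
    have : u = y := sub_eq_zero.1 h
    rw [this] at hu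
    exact (Metric.mem_ball.1 hy).ne (Metric.mem_sphere.1 hu)
  induction r generalizing Q with
  | zero =>
    obtain ⟨Q', hQ'⟩ := Polynomial.X_sub_C_dvd_sub_C_eval (a := x) (p := Q)
    refine ⟨Q.eval x * (2 * Real.pi * Complex.I), fun c R h1 hx => ?_⟩
    have hR : 0 < R := dist_nonneg.trans_lt hx
    have hcong : ∮ u in C(c, R), Q.eval u * ((u - 1)⁻¹) ^ 0 * (u - x)⁻¹ =
        ∮ u in C(c, R), (Q'.eval u + Q.eval x * (u - x)⁻¹) := by
      refine circleIntegral.integral_congr hR.le fun u hu => ?_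
      have hne := hsub hx hu
      have := congrArg (Polynomial.eval u) hQ'
      simp only [Polynomial.eval_sub, Polynomial.eval_C, Polynomial.eval_mul,
        Polynomial.eval_X] at this
      have hQu : Q.eval u = Q.eval x + (u - x) * Q'.eval u := by linear_combination this
      rw [hQu]
      field_simp
      ring
    have hint : CircleIntegrable (fun u => Q.eval x * (u - x)⁻¹) c R :=
      (continuousOn_const.mul (continuousOn_sphere_inv_sub hx)).circleIntegrable hR.le
    rw [hcong, circleIntegral.integral_add
      (Q'.continuous.continuousOn.circleIntegrable hR.le) hint,
      circleIntegral_polynomial _ _ _ hR.le, circleIntegral.integral_const_mul,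
      circleIntegral.integral_sub_inv_of_mem_ball hx, zero_add]
  -- Partial fractions lower the order of the pole at `1`: write `Q(u) = Q(1) + (u-1)Q'(u)` and use
  -- `1/((u-1)(u-x)) = (1/(u-x) - 1/(u-1))/(x-1)`. The pure power left over integrates to `2πi` or
  -- `0` whatever the circle.
  | succ r ih =>
    obtain ⟨Q', hQ'⟩ := Polynomial.X_sub_C_dvd_sub_C_eval (a := 1) (p := Q)
    obtain ⟨V, hV⟩ := ih (Q' + Polynomial.C (Q.eval 1 / (x - 1)))
    refine ⟨V - Q.eval 1 / (x - 1) * (if r = 0 then 2 * Real.pi * Complex.I else 0),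
      fun c R h1 hx => ?_⟩
    have hR : 0 < R := dist_nonneg.trans_lt hx
    have hx1' : x - 1 ≠ 0 := sub_ne_zero.2 hx1
    have hpole : ∮ u in C(c, R), ((u - 1)⁻¹) ^ (r + 1) =
        if r = 0 then 2 * Real.pi * Complex.I else 0 := by
      split_ifs with h
      · subst h
        simpa using circleIntegral.integral_sub_inv_of_mem_ball h1
      · rw [← circleIntegral.integral_sub_zpow_of_ne (n := -(r + 1 : ℕ)) (by omega) c 1 R]
        congr 1
        ext u
        rw [zpow_neg, zpow_natCast, inv_pow]
    have hcong : ∮ u in C(c, R), Q.eval u * ((u - 1)⁻¹) ^ (r + 1) * (u - x)⁻¹ =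
        ∮ u in C(c, R), ((Q' + Polynomial.C (Q.eval 1 / (x - 1))).eval u * ((u - 1)⁻¹) ^ r *
          (u - x)⁻¹ - Q.eval 1 / (x - 1) * ((u - 1)⁻¹) ^ (r + 1)) := by
      refine circleIntegral.integral_congr hR.le fun u hu => ?_
      have hne := hsub hx hu
      have hne1 := hsub h1 hu
      have := congrArg (Polynomial.eval u) hQ'
      simp only [Polynomial.eval_sub, Polynomial.eval_C, Polynomial.eval_mul,
        Polynomial.eval_X] at this
      have hQu : Q.eval u = Q.eval 1 + (u - 1) * Q'.eval u := by linear_combination this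
      simp only [Polynomial.eval_add, Polynomial.eval_C]
      rw [hQu, pow_succ]
      field_simp
      ring
    have hint : CircleIntegrable (fun u => Q.eval 1 / (x - 1) * ((u - 1)⁻¹) ^ (r + 1)) c R :=
      (continuousOn_const.mul ((continuousOn_sphere_inv_sub h1).pow _)).circleIntegrable hR.le
    rw [hcong, circleIntegral.integral_sub
      ((continuousOn_sphere_rational _ r h1 hx).circleIntegrable hR.le) hint,
      hV c R h1 hx, circleIntegral.integral_const_mul, hpole]

/-! ### The circle `|u - 1| = 2` seen from the point `-1` -/

/-- The substitution `ψ = l² t² / 4`. -/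
theorem setIntegral_Ioo_pi_eq (l : ℝ) (hl : 0 < l) (g : ℝ → ℂ) :
    ∫ ψ in Ioo 0 Real.pi, g ψ =
      ∫ t in Ioo 0 (2 * Real.sqrt Real.pi / l), (l ^ 2 * t / 2 : ℝ) * g (l ^ 2 * t ^ 2 / 4) := by
  have himg : (fun t : ℝ => l ^ 2 * t ^ 2 / 4) '' Ioo 0 (2 * Real.sqrt Real.pi / l) =
      Ioo 0 Real.pi := by
    ext ψ
    constructor
    · rintro ⟨t, ⟨h1, h2⟩, rfl⟩
      refine ⟨by positivity, ?_⟩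
      rw [lt_div_iff₀ hl] at h2
      have h3 : (t * l) ^ 2 < (2 * Real.sqrt Real.pi) ^ 2 := by gcongr
      rw [mul_pow 2, Real.sq_sqrt Real.pi_pos.le] at h3
      dsimp only
      linarith
    · rintro ⟨h1, h2⟩
      refine ⟨2 * Real.sqrt ψ / l, ⟨by positivity, ?_⟩, ?_⟩
      · have := Real.sqrt_lt_sqrt h1.le h2
        gcongr
      · have := Real.sq_sqrt h1.le
        field_simp
        linarith
  have hinj : InjOn (fun t : ℝ => l ^ 2 * t ^ 2 / 4) (Ioo 0 (2 * Real.sqrt Real.pi / l)) := by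
    intro t ht t' ht' h
    have h' : t ^ 2 = t' ^ 2 := by
      have : l ^ 2 * t ^ 2 / 4 = l ^ 2 * t' ^ 2 / 4 := h
      field_simp at this
      exact this
    exact (sq_eq_sq₀ ht.1.le ht'.1.le).1 h'
  have hder : ∀ t ∈ Ioo 0 (2 * Real.sqrt Real.pi / l),
      HasDerivWithinAt (fun t : ℝ => l ^ 2 * t ^ 2 / 4) (l ^ 2 * t / 2)
        (Ioo 0 (2 * Real.sqrt Real.pi / l)) t := by
    intro t _
    refine ((((hasDerivAt_pow 2 t).const_mul (l ^ 2)).div_const 4).congr_deriv ?_).hasDerivWithinAt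
    push_cast
    ring
  rw [← himg, integral_image_eq_integral_abs_deriv_smul measurableSet_Ioo hder hinj]
  refine setIntegral_congr_fun measurableSet_Ioo fun t ht => ?_
  have h1 : 0 < t := ht.1
  rw [abs_of_pos (by positivity), Complex.real_smul]

/-- The direction `e^{iπ/4}` or `e^{-iπ/4}` of one of the two rays. -/
def rayDir (b : Bool) : ℂ :=
  if b then Complex.exp ((Real.pi : ℂ) / 4 * Complex.I)
  else Complex.exp (-((Real.pi : ℂ) / 4 * Complex.I))

theorem rayDir_sq (b : Bool) : rayDir b ^ 2 = if b then Complex.I else -Complex.I := by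
  have h : (2 : ℕ) * ((Real.pi : ℂ) / 4 * Complex.I) = (Real.pi : ℂ) / 2 * Complex.I := by
    push_cast; ring
  have h' : (2 : ℕ) * (-((Real.pi : ℂ) / 4 * Complex.I)) = -(Real.pi : ℂ) / 2 * Complex.I := by
    push_cast; ring
  cases b
  · simp only [rayDir, Bool.false_eq_true, if_false]
    rw [← Complex.exp_nat_mul, h', Complex.exp_neg_pi_div_two_mul_I]
  · simp only [rayDir, if_true]
    rw [← Complex.exp_nat_mul, h, Complex.exp_pi_div_two_mul_I]

/-- The point `e^{∓iψ}` of the unit circle. -/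
def circlePt (b : Bool) (ψ : ℝ) : ℂ := Complex.exp (-(rayDir b ^ 2 * ψ))

theorem circleIntegral_one_two_eq (l : ℝ) (hl : 0 < l) (f : ℂ → ℂ)
    (hf : ContinuousOn f (Metric.sphere 1 2)) :
    ∮ u in C(1, 2), f u = ∑ b : Bool, ∫ t in Ioo 0 (2 * Real.sqrt Real.pi / l),
      (l ^ 2 * t / 2 : ℝ) * (-2 * Complex.I * circlePt b (l ^ 2 * t ^ 2 / 4) *
        f (1 - 2 * circlePt b (l ^ 2 * t ^ 2 / 4))) := by
  -- The angle is shifted by `π` so that `φ = 0` is the point `u = -1`; the signs of `φ` give the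
  -- two half circles.
  set g : ℝ → ℂ := fun φ => -2 * Complex.I * Complex.exp (φ * Complex.I) *
    f (1 - 2 * Complex.exp (φ * Complex.I)) with hg
  have hgc : Continuous g := by
    refine Continuous.mul (by fun_prop) (hf.comp_continuous (by fun_prop) fun φ => ?_)
    simp [Complex.norm_exp_ofReal_mul_I]
  have hexp : ∀ φ : ℝ, Complex.exp ((φ + Real.pi : ℝ) * Complex.I) =
      -Complex.exp (φ * Complex.I) := by
    intro φ
    push_cast
    rw [add_mul, Complex.exp_add, Complex.exp_pi_mul_I]
    ring
  have h1 : ∮ u in C(1, 2), f u = ∫ φ in (-Real.pi)..Real.pi, g φ := by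
    rw [circleIntegral]
    have : ∀ φ : ℝ, g φ =
        (fun θ => deriv (circleMap 1 2) θ • f (circleMap 1 2 θ)) (φ + Real.pi) := by
      intro φ
      simp only [hg, deriv_circleMap, circleMap, hexp, smul_eq_mul]
      push_cast
      ring_nf
    simp_rw [this]
    rw [intervalIntegral.integral_comp_add_right
      (fun θ => deriv (circleMap 1 2) θ • f (circleMap 1 2 θ))]
    congr 1 <;> ring
  have h2 : ∫ φ in (-Real.pi)..Real.pi, g φ =
      (∫ φ in (0)..Real.pi, g (-φ)) + ∫ φ in (0)..Real.pi, g φ := by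
    rw [← intervalIntegral.integral_add_adjacent_intervals (hgc.intervalIntegrable _ 0)
      (hgc.intervalIntegrable 0 _), intervalIntegral.integral_comp_neg, neg_zero]
  have h3 : ∀ h : ℝ → ℂ, ∫ φ in (0)..Real.pi, h φ = ∫ φ in Ioo 0 Real.pi, h φ := fun h => by
    rw [intervalIntegral.integral_of_le Real.pi_pos.le, integral_Ioc_eq_integral_Ioo]
  have ht : ∀ ψ : ℝ, circlePt true ψ = Complex.exp ((-ψ : ℝ) * Complex.I) := fun ψ => by
    simp only [circlePt, rayDir_sq, if_true]; push_cast; ring_nf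
  have hf' : ∀ ψ : ℝ, circlePt false ψ = Complex.exp ((ψ : ℝ) * Complex.I) := fun ψ => by
    simp only [circlePt, rayDir_sq, Bool.false_eq_true, if_false]; ring_nf
  rw [h1, h2, h3, h3, setIntegral_Ioo_pi_eq l hl, setIntegral_Ioo_pi_eq l hl, Fintype.sum_bool]
  simp only [ht, hf', hg]

/-- A square root of `1 - e^{∓iψ}`. -/
def circleRoot (b : Bool) (ψ : ℝ) : ℂ :=
  Real.sqrt (2 * Real.sin (ψ / 2)) * rayDir b * circlePt b (ψ / 4)

theorem circlePt_ne_zero (b : Bool) (ψ : ℝ) : circlePt b ψ ≠ 0 := Complex.exp_ne_zero _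

theorem circlePt_half_sq (b : Bool) (ψ : ℝ) : circlePt b (ψ / 2) ^ 2 = circlePt b ψ := by
  rw [circlePt, circlePt, ← Complex.exp_nat_mul]
  congr 1
  push_cast
  ring

theorem norm_circlePt (b : Bool) (ψ : ℝ) : ‖circlePt b ψ‖ = 1 := by
  rw [circlePt, Complex.norm_exp, rayDir_sq]
  cases b <;> simp

theorem norm_rayDir (b : Bool) : ‖rayDir b‖ = 1 := by
  have h := congrArg norm (rayDir_sq b)
  rw [norm_pow] at h
  have h1 : ‖rayDir b‖ ^ 2 = 1 := by rw [h]; cases b <;> simp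
  exact (pow_eq_one_iff_of_nonneg (norm_nonneg _) two_ne_zero).1 h1

/-- This is `1 - e^{∓iψ} = 2 sin(ψ/2) · (±i) · e^{∓iψ/2}`, with `±i = rayDir b ^ 2`. The explicit
root avoids branch choices and shows both its size and its direction as `ψ → 0`. -/
theorem circleRoot_sq (b : Bool) (ψ : ℝ) (h0 : 0 ≤ ψ) (h1 : ψ ≤ Real.pi) :
    circleRoot b ψ ^ 2 = 1 - circlePt b (ψ / 2) ^ 2 := by
  have hs : 0 ≤ 2 * Real.sin (ψ / 2) :=
    mul_nonneg two_pos.le (Real.sin_nonneg_of_nonneg_of_le_pi (by linarith) (by linarith))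
  have e1 : circlePt b (ψ / 4) ^ 2 = circlePt b (ψ / 2) := by
    rw [← circlePt_half_sq b (ψ / 2)]; congr 2; ring
  have e2 : ((Real.sqrt (2 * Real.sin (ψ / 2)) : ℝ) : ℂ) ^ 2 = 2 * Complex.sin (ψ / 2 : ℝ) := by
    rw [← Complex.ofReal_pow, Real.sq_sqrt hs]
    push_cast
    ring
  have hinv : circlePt b (ψ / 2) * Complex.exp (rayDir b ^ 2 * (ψ / 2 : ℝ)) = 1 := by
    rw [circlePt, ← Complex.exp_add, neg_add_cancel, Complex.exp_zero]
  have key : 2 * Complex.sin (ψ / 2 : ℝ) * rayDir b ^ 2 =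
      Complex.exp (rayDir b ^ 2 * (ψ / 2 : ℝ)) - circlePt b (ψ / 2) := by
    rw [circlePt, rayDir_sq, Complex.sin]
    cases b
    · simp only [Bool.false_eq_true, if_false]
      ring_nf
      rw [Complex.I_sq]
      ring
    · simp only [if_true]
      ring_nf
      rw [Complex.I_sq]
      ring_nf
  rw [circleRoot, mul_pow, mul_pow, e1, e2, key]
  linear_combination hinv

theorem norm_circleRoot_le (b : Bool) (ψ : ℝ) (h0 : 0 ≤ ψ) :
    ‖circleRoot b ψ‖ ≤ Real.sqrt ψ := by
  rw [circleRoot, norm_mul, norm_mul, norm_rayDir, norm_circlePt, mul_one, mul_one,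
    Complex.norm_real, Real.norm_of_nonneg (Real.sqrt_nonneg _)]
  exact Real.sqrt_le_sqrt (by linarith [Real.sin_le (x := ψ / 2) (by linarith)])

/-! ### The double integral in scaled coordinates -/

/-- The part of the integrand of the double integral depending on `x = -cos y`. -/
def lineFactor (ρ : ℝ) (n r e k : ℕ) (y : ℝ) : ℝ :=
  Real.cos (y / 2) ^ (2 * r + e) / (1 - ρ * Real.sin (y / 2) ^ 2) ^ n * Real.cos (k * (y / 2))

/-- The polynomial `J_s`, up to sign and a power, on the circle `|u - 1| = 2`. -/
def circleJacobi (k : ℕ) (b : Bool) (ψ : ℝ) : ℂ :=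
  ((circlePt b (ψ / 2) + Complex.I * circleRoot b ψ) ^ k +
    (circlePt b (ψ / 2) - Complex.I * circleRoot b ψ) ^ k) / 2

/-- The part of the integrand of the double integral depending on `u = 1 - 2 e^{∓iψ}`. -/
def circleFactor (ρ : ℝ) (n r e k : ℕ) (b : Bool) (ψ : ℝ) : ℂ :=
  ((1 - ρ) + ρ * circlePt b ψ) ^ n / circlePt b ψ ^ r *
    (circlePt b ψ * circleJacobi k b ψ / circlePt b (ψ / 2) ^ e)

/-- The double integral of the kernel after the substitutions `x = -cos (l ξ)` and
`u = 1 - 2 exp (∓ i l² t² / 4)`. -/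
theorem double_integral_eq (α : ℝ) (hα : 0 < α) (ρ : ℝ) (hρ : ρ = 1 - ((1 + α) ^ 2)⁻¹)
    (l : ℝ) (hl : 0 < l) (n r₁ r₂ s₁ s₂ : ℕ) (a₁ a₂ : HalfSign) :
    (∫ x in (-1 : ℝ)..1, ∮ u in C(0, 2),
      phi α (x : ℂ) ^ n / phi α u ^ n *
        (jacobi a₁ s₁).eval (x : ℂ) * (jacobi a₂ s₂).eval u *
        (((x : ℂ) - 1) ^ r₁ / (u - 1) ^ r₂) * (weight a₁ x / ((x : ℂ) - u))) =
    (-2 : ℂ) ^ ((r₁ : ℤ) - (r₂ : ℤ)) * (-1 : ℂ) ^ (s₁ + s₂) * 2 ^ a₁.shift * (-Complex.I / 2) * l *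
      ∫ ξ in Ioo 0 (Real.pi / l), ∑ b : Bool, ∫ t in Ioo 0 (2 * Real.sqrt Real.pi / l),
        (lineFactor ρ n r₁ a₁.shift (2 * s₁ + a₁.shift) (l * ξ) : ℂ) *
          circleFactor ρ n r₂ a₂.shift (2 * s₂ + a₂.shift) b (l ^ 2 * t ^ 2 / 4) *
          ((l ^ 2 * t : ℝ) / (circlePt b (l ^ 2 * t ^ 2 / 4) - (Real.cos (l *
              ξ / 2) ^ 2 : ℝ))) := by
  -- Here `1/φ_α(z) = 1 + β(1-z)` takes the value `1 + 2β = (1+α)²` at `z = -1`. Dividing by that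
  -- value produces `ρ = 2β/(1+2β)`.
  set β : ℝ := α + α ^ 2 / 2 with hβ
  have hβ0 : 0 < β := by positivity
  have hβ1 : 1 + 2 * β = (1 + α) ^ 2 := by rw [hβ]; ring
  have hρβ : ρ * (1 + 2 * β) = 2 * β := by
    rw [hρ, hβ1]
    field_simp
    linarith
  have hphi : ∀ z, phi α z = (1 + β * (1 - z))⁻¹ := by
    intro z
    rw [phi, hβ]
    push_cast
    ring_nf
  set Q : Polynomial ℂ :=
    (Polynomial.C (1 + (β : ℂ)) - Polynomial.C (β : ℂ) * Polynomial.X) ^ n * jacobi a₂ s₂ with hQ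
  have hQe : ∀ u, Q.eval u = (1 + β * (1 - u)) ^ n * (jacobi a₂ s₂).eval u := by
    intro u
    simp only [hQ, Polynomial.eval_mul, Polynomial.eval_pow, Polynomial.eval_sub,
      Polynomial.eval_C, Polynomial.eval_X]
    ring
  have hG : ∀ x : ℝ, (∮ u in C(0, 2), phi α (x : ℂ) ^ n / phi α u ^ n *
        (jacobi a₁ s₁).eval (x : ℂ) * (jacobi a₂ s₂).eval u *
        (((x : ℂ) - 1) ^ r₁ / (u - 1) ^ r₂) * (weight a₁ x / ((x : ℂ) - u))) =
      (-(phi α x ^ n * (jacobi a₁ s₁).eval (x : ℂ) * ((x : ℂ) - 1) ^ r₁) *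
        ∮ u in C(0, 2), Q.eval u * ((u - 1)⁻¹) ^ r₂ * (u - x)⁻¹) * weight a₁ x := by
    intro x
    rw [mul_right_comm, ← circleIntegral.integral_const_mul]
    congr 1
    ext u
    rw [hQe, hphi u, ← neg_sub u (x : ℂ), inv_pow, div_inv_eq_mul, inv_pow, div_neg]
    simp only [div_eq_mul_inv]
    ring
  simp_rw [hG]
  rw [integral_mul_weight a₁ l hl, mul_comm _ (l : ℂ), mul_assoc (l : ℂ)]
  congr 1
  rw [← integral_const_mul]
  refine setIntegral_congr_fun measurableSet_Ioo fun ξ hξ => ?_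
  have hξ' : l * ξ ∈ Ioo 0 Real.pi := by
    refine ⟨mul_pos hl hξ.1, ?_⟩
    have := (lt_div_iff₀ hl).1 hξ.2
    linarith
  have hc : 0 < Real.cos (l * ξ / 2) :=
    Real.cos_pos_of_mem_Ioo ⟨by linarith [hξ'.1, Real.pi_pos], by linarith [hξ'.2]⟩
  have hs : 0 < Real.sin (l * ξ / 2) :=
    Real.sin_pos_of_pos_of_lt_pi (by linarith [hξ'.1]) (by linarith [hξ'.1, hξ'.2])
  have hcs := Real.sin_sq_add_cos_sq (l * ξ / 2)
  have hcos : Real.cos (l * ξ) = 2 * Real.cos (l * ξ / 2) ^ 2 - 1 := by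
    rw [← Real.cos_two_mul]; ring_nf
  set c := Real.cos (l * ξ / 2) with hcdef
  have hJ := jacobi_eval_neg_cos a₁ s₁ (l * ξ) hc.ne'
  rw [← hcdef] at hJ
  have hx : (-Real.cos (l * ξ) : ℝ) = 1 - 2 * c ^ 2 := by rw [hcos]; ring
  have hc1 : c ^ 2 < 1 := by nlinarith
  have hb0 : ((-Real.cos (l * ξ) : ℝ) : ℂ) ∈ Metric.ball (0 : ℂ) 2 := by
    rw [mem_ball_zero_iff, Complex.norm_real, Real.norm_eq_abs, hx, abs_lt]
    constructor <;> nlinarith [sq_nonneg c]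
  have hb1 : ((-Real.cos (l * ξ) : ℝ) : ℂ) ∈ Metric.ball (1 : ℂ) 2 := by
    rw [Metric.mem_ball, Complex.dist_eq, ← Complex.ofReal_one, ← Complex.ofReal_sub,
      Complex.norm_real, Real.norm_eq_abs, hx, abs_lt]
    constructor <;> nlinarith [sq_nonneg c]
  have hx1 : ((-Real.cos (l * ξ) : ℝ) : ℂ) ≠ 1 := by
    rw [hx]
    norm_cast
    nlinarith [pow_pos hc 2, hx]
  -- As `-1 < x < 1` strictly, both `x` and `1` lie inside each of the circles, although the new one
  -- passes through `-1`.
  obtain ⟨V, hV⟩ := exists_circleIntegral_rational_eq _ hx1 r₂ Q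
  have hmove := (hV 0 2 (by simp) hb0).trans (hV 1 2 (by simp) hb1).symm
  rw [hmove, circleIntegral_one_two_eq l hl _ (continuousOn_sphere_rational Q r₂ (by simp) hb1),
    Finset.mul_sum, Finset.sum_mul, Finset.mul_sum]
  refine Finset.sum_congr rfl fun b _ => ?_
  rw [← integral_const_mul, ← integral_mul_const, ← integral_const_mul]
  refine setIntegral_congr_fun measurableSet_Ioo fun t ht => ?_
  have ht0 : 0 < t := ht.1
  set ψ : ℝ := l ^ 2 * t ^ 2 / 4 with hψ
  have hψ0 : 0 ≤ ψ := by positivity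
  have hψ1 : ψ ≤ Real.pi := by
    have h2 := (lt_div_iff₀ hl).1 ht.2
    have h3 : (t * l) ^ 2 ≤ (2 * Real.sqrt Real.pi) ^ 2 := by gcongr
    rw [mul_pow 2, Real.sq_sqrt Real.pi_pos.le] at h3
    rw [hψ]
    linarith
  have hJ2 := jacobi_eval_one_sub a₂ s₂ _ _ (circlePt_ne_zero b (ψ / 2)) (circleRoot_sq b ψ hψ0 hψ1)
  rw [circlePt_half_sq] at hJ2
  have hE := circlePt_ne_zero b ψ
  have hH := circlePt_ne_zero b (ψ / 2)
  rw [hJ, hQe, hJ2, hphi, hx, lineFactor, circleFactor, circleJacobi, ← hcdef]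
  set E := circlePt b ψ with hEdef
  set J := ((circlePt b (ψ / 2) + Complex.I * circleRoot b ψ) ^ (2 * s₂ + a₂.shift) +
    (circlePt b (ψ / 2) - Complex.I * circleRoot b ψ) ^ (2 * s₂ + a₂.shift)) / 2
  set H := circlePt b (ψ / 2)
  set K := Real.cos ((2 * s₁ + a₁.shift : ℕ) * (l * ξ / 2))
  set e₁ := a₁.shift
  set e₂ := a₂.shift
  have hcC : (c : ℂ) ≠ 0 := by exact_mod_cast hc.ne'
  have hD : (0 : ℝ) < 1 + β * (2 * c ^ 2) := by positivity
  have hDC : (1 : ℂ) + β * (2 * c ^ 2) ≠ 0 := by exact_mod_cast hD.ne'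
  have hB : (0 : ℝ) < 1 + 2 * β := by positivity
  have hBC : (1 : ℂ) + 2 * β ≠ 0 := by exact_mod_cast hB.ne'
  have hρC : (ρ : ℂ) = 2 * β / (1 + 2 * β) := by
    rw [eq_div_iff hBC]; exact_mod_cast hρβ
  have hsC : Complex.sin (l * ξ / 2) ^ 2 = 1 - (c : ℂ) ^ 2 := by
    have : ((Real.sin (l * ξ / 2) : ℝ) : ℂ) ^ 2 = 1 - (c : ℂ) ^ 2 := by norm_cast; linarith
    rw [← this]
    push_cast
    rfl
  have q1 : (1 : ℂ) - ρ * Complex.sin (l * ξ / 2) ^ 2 = (1 + β * (2 * c ^ 2)) / (1 + 2 * β) := by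
    rw [hsC, hρC]; field_simp; ring
  have q2 : (1 - ρ : ℂ) + ρ * E = (1 + β * (2 * E)) / (1 + 2 * β) := by
    rw [hρC]; field_simp; ring
  have q3 : (1 - 2 * E - (1 - 2 * (c : ℂ) ^ 2)) = -(2 * (E - (c : ℂ) ^ 2)) := by ring
  have q4 : (1 - (1 - 2 * (c : ℂ) ^ 2)) = 2 * (c : ℂ) ^ 2 := by ring
  have q5 : (1 - (1 - 2 * E)) = 2 * E := by ring
  have q6 : (1 - 2 * E - 1) = -2 * E := by ring
  have q7 : (1 - 2 * (c : ℂ) ^ 2 - 1) = -2 * (c : ℂ) ^ 2 := by ring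
  have h2 : (-2 : ℂ) ≠ 0 := by norm_num
  push_cast
  rw [q1, q2, q3, q4, q5, q6, q7, zpow_sub₀ h2, zpow_natCast, zpow_natCast, inv_neg, mul_inv]
  simp only [div_eq_mul_inv, mul_pow, mul_inv, inv_pow, inv_neg, inv_inv, pow_add]
  -- The two cancellations that are not formal: the weight against the denominator of the
  -- polynomial, and the normalisations `(1+2β)^n` of the two `φ_α` factors. The remaining
  -- quantities are made opaque for the closing polynomial identity.
  have hcc : ((c : ℂ) ^ e₁)⁻¹ * (c ^ 2) ^ e₁ = (c : ℂ) ^ e₁ := by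
    rw [← pow_mul, mul_comm 2, pow_mul]
    field_simp
  have hbb : ((1 + 2 * (β : ℂ)) ^ n)⁻¹ * (1 + 2 * (β : ℂ)) ^ n = 1 :=
    inv_mul_cancel₀ (pow_ne_zero _ hBC)
  generalize (E - (c : ℂ) ^ 2)⁻¹ = X
  generalize ((1 + (β : ℂ) * (2 * c ^ 2)) ^ n)⁻¹ = X4
  generalize ((1 + 2 * (β : ℂ)) ^ n)⁻¹ = X5 at *
  generalize (1 + 2 * (β : ℂ)) ^ n = X6 at *
  rw [show (c : ℂ) ^ (2 * r₁) = (c ^ 2) ^ r₁ from pow_mul _ _ _]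
  generalize ((c : ℂ) ^ e₁)⁻¹ = X7 at *
  generalize (c : ℂ) ^ e₁ = X9 at *
  generalize ((c : ℂ) ^ 2) ^ e₁ = X8 at *
  generalize ((c : ℂ) ^ 2) ^ r₁ = X10 at *
  rw [show ((-2⁻¹ : ℂ)) ^ r₂ = ((-2) ^ r₂)⁻¹ by rw [← inv_pow, inv_neg]]
  generalize ((-2 : ℂ) ^ r₂)⁻¹ = X11
  generalize (-2 : ℂ) ^ r₁ = X12
  generalize (-1 : ℂ) ^ s₁ = X13
  generalize (-1 : ℂ) ^ s₂ = X14
  generalize (1 + (β : ℂ) * (2 * E)) ^ n = X15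
  linear_combination (-(1 / 2) * Complex.I * X4 * X13 * K * X12 * X10 * l ^ 2 * t * E * X15 * X14 *
    J * (H ^ e₂)⁻¹ * X11 * (E ^ r₂)⁻¹ * X * 2 ^ e₁) * (hcc - X9 * hbb)

/-! ### The scaling regime and pointwise limits -/

/-- The scaling of `n` and `r` in terms of the mesh size `l`. -/
structure IsScaling (ρ η : ℝ) (l : ℕ → ℝ) (n r : ℕ → ℕ) : Prop where
  rho_pos : 0 < ρ
  rho_lt_one : ρ < 1
  pos : ∀ᶠ N in atTop, 0 < l N
  tendsto_zero : Tendsto l atTop (𝓝 0)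
  time : Tendsto (fun N => (n N : ℝ) * l N ^ 4 * (ρ * (1 - ρ))) atTop (𝓝 32)
  level : Tendsto (fun N => ((r N : ℝ) - ρ * n N) * l N ^ 2) atTop (𝓝 (4 * η))

theorem tendsto_one_add_pow_exp {g : ℕ → ℂ} {k : ℕ → ℕ} {z : ℂ} (hg : Tendsto g atTop (𝓝 0))
    (hk : Tendsto (fun N => (k N : ℂ) * g N) atTop (𝓝 z)) :
    Tendsto (fun N => (1 + g N) ^ k N) atTop (𝓝 (Complex.exp z)) := by
  have hsmall : ∀ᶠ N in atTop, ‖g N‖ < 1 / 2 := by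
    have := hg.norm
    rw [norm_zero] at this
    exact this.eventually_lt_const (by norm_num)
  have hrem : Tendsto (fun N => (k N : ℂ) * (Complex.log (1 + g N) - g N)) atTop (𝓝 0) := by
    have h0 : Tendsto (fun N => ‖(k N : ℂ) * g N‖ * ‖g N‖) atTop (𝓝 0) := by
      simpa using hk.norm.mul hg.norm
    refine squeeze_zero_norm' (hsmall.mono fun N hN => ?_) h0
    have h1 := Complex.norm_log_one_add_sub_self_le (z := g N) (by linarith)
    have h2 : (1 - ‖g N‖)⁻¹ ≤ 2 := by
      rw [inv_le_comm₀ (by linarith) two_pos]; linarith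
    rw [norm_mul, norm_mul, mul_assoc]
    gcongr
    calc _ ≤ _ := h1
      _ ≤ ‖g N‖ ^ 2 * 2 / 2 := by gcongr
      _ = _ := by ring
  have h := (Complex.continuous_exp.tendsto _).comp (hrem.add hk)
  rw [zero_add] at h
  refine h.congr' (hsmall.mono fun N hN => ?_)
  have hne : 1 + g N ≠ 0 := by
    intro h0
    have : g N = -1 := by linear_combination h0
    rw [this] at hN
    norm_num at hN
  simp only [Function.comp]
  rw [← mul_add, sub_add_cancel, Complex.exp_nat_mul, Complex.exp_log hne]

theorem norm_log_one_add_sub_le {z : ℂ} (hz : ‖z‖ ≤ 1 / 2) :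
    ‖Complex.log (1 + z) - (z - z ^ 2 / 2)‖ ≤ ‖z‖ ^ 3 := by
  have h1 := Complex.norm_log_sub_logTaylor_le 2 (z := z) (by linarith)
  have h2 : (1 - ‖z‖)⁻¹ ≤ 2 := by
    rw [inv_le_comm₀ (by linarith) two_pos]; linarith
  have h3 : Complex.logTaylor (2 + 1) z = z - z ^ 2 / 2 := by
    simp [Complex.logTaylor_succ, Complex.logTaylor_zero]
    ring
  rw [h3] at h1
  refine h1.trans ?_
  calc ‖z‖ ^ (2 + 1) * (1 - ‖z‖)⁻¹ / ((2 : ℕ) + 1) ≤ ‖z‖ ^ (2 + 1) * 2 / ((2 : ℕ) + 1) := by gcongr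
    _ ≤ ‖z‖ ^ 3 := by
      norm_num
      have : 0 ≤ ‖z‖ ^ 3 := by positivity
      linarith

theorem tendsto_zero_of_div_sq {l : ℕ → ℝ} (hpos : ∀ᶠ N in atTop, 0 < l N)
    (hl : Tendsto l atTop (𝓝 0)) {h : ℕ → ℂ} {ζ : ℂ}
    (hh : Tendsto (fun N => h N / (l N : ℂ) ^ 2) atTop (𝓝 ζ)) : Tendsto h atTop (𝓝 0) := by
  have hlC : Tendsto (fun N => (l N : ℂ)) atTop (𝓝 0) := by
    simpa [Function.comp_def] using (Complex.continuous_ofReal.tendsto 0).comp hl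
  have := hh.mul (hlC.pow 2)
  rw [zero_pow two_ne_zero, mul_zero] at this
  refine this.congr' (hpos.mono fun N hN => ?_)
  have : (l N : ℂ) ≠ 0 := by exact_mod_cast hN.ne'
  field_simp

/-- The remainder is `O(h³) = O(l⁶)`, so it stays negligible after multiplication by `n` or `r`,
which are of order `l⁻⁴`. -/
theorem tendsto_log_remainder {l : ℕ → ℝ} (hpos : ∀ᶠ N in atTop, 0 < l N)
    (hl : Tendsto l atTop (𝓝 0)) {h : ℕ → ℂ} {ζ : ℂ}
    (hh : Tendsto (fun N => h N / (l N : ℂ) ^ 2) atTop (𝓝 ζ)) :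
    Tendsto (fun N => (Complex.log (1 + h N) - (h N - h N ^ 2 / 2)) / (l N : ℂ) ^ 4) atTop
      (𝓝 0) := by
  have h0 := tendsto_zero_of_div_sq hpos hl hh
  have hsmall : ∀ᶠ N in atTop, ‖h N‖ < 1 / 2 := by
    have := h0.norm
    rw [norm_zero] at this
    exact this.eventually_lt_const (by norm_num)
  have hb : Tendsto (fun N => ‖h N / (l N : ℂ) ^ 2‖ ^ 2 * ‖h N‖) atTop (𝓝 0) := by
    simpa using (hh.norm.pow 2).mul h0.norm
  refine squeeze_zero_norm' ((hsmall.and hpos).mono fun N hN => ?_) hb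
  rw [norm_div, norm_pow, norm_div, norm_pow, Complex.norm_real, Real.norm_of_nonneg hN.2.le,
    div_pow, ← pow_mul, div_mul_eq_mul_div]
  have h1 := norm_log_one_add_sub_le hN.1.le
  have h2 := hN.2
  gcongr
  calc _ ≤ _ := h1
    _ = _ := by ring

theorem IsScaling.tendsto_time {ρ η : ℝ} {l : ℕ → ℝ} {n r : ℕ → ℕ} (H : IsScaling ρ η l n r) :
    Tendsto (fun N => (n N : ℝ) * l N ^ 4) atTop (𝓝 (32 / (ρ * (1 - ρ)))) := by
  have h : ρ * (1 - ρ) ≠ 0 := (mul_pos H.rho_pos (sub_pos.2 H.rho_lt_one)).ne'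
  exact (H.time.div_const (ρ * (1 - ρ))).congr fun N => mul_div_cancel_right₀ _ h

theorem IsScaling.tendsto_level {ρ η : ℝ} {l : ℕ → ℝ} {n r : ℕ → ℕ} (H : IsScaling ρ η l n r) :
    Tendsto (fun N => (r N : ℝ) * l N ^ 4) atTop (𝓝 (ρ * (32 / (ρ * (1 - ρ))))) := by
  have := (H.level.mul (H.tendsto_zero.pow 2)).add (H.tendsto_time.const_mul ρ)
  rw [zero_pow two_ne_zero, mul_zero, zero_add] at this
  exact this.congr fun N => by ring

/-- Fourth order asymptotics at the critical point. -/
theorem IsScaling.tendsto_pow_div_pow {ρ η : ℝ} {l : ℕ → ℝ} {n r : ℕ → ℕ}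
    (H : IsScaling ρ η l n r) {h : ℕ → ℂ} {ζ : ℂ}
    (hh : Tendsto (fun N => h N / (l N : ℂ) ^ 2) atTop (𝓝 ζ)) :
    Tendsto (fun N => (1 - h N) ^ r N / (1 - ρ * h N) ^ n N) atTop
      (𝓝 (Complex.exp (-(4 * η * ζ) - 16 * ζ ^ 2))) := by
  have hof : ∀ {f : ℕ → ℝ} {a : ℝ}, Tendsto f atTop (𝓝 a) →
      Tendsto (fun N => (f N : ℂ)) atTop (𝓝 (a : ℂ)) := fun hf =>
    (Complex.continuous_ofReal.tendsto _).comp hf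
  have hh1 : Tendsto (fun N => (-h N) / (l N : ℂ) ^ 2) atTop (𝓝 (-ζ)) :=
    hh.neg.congr fun N => by ring
  have hh2 : Tendsto (fun N => (-(ρ * h N)) / (l N : ℂ) ^ 2) atTop (𝓝 (-(ρ * ζ))) :=
    (hh.const_mul (ρ : ℂ)).neg.congr fun N => by ring
  have R1 := tendsto_log_remainder H.pos H.tendsto_zero hh1
  have R2 := tendsto_log_remainder H.pos H.tendsto_zero hh2
  have z1 := tendsto_zero_of_div_sq H.pos H.tendsto_zero hh1
  have z2 := tendsto_zero_of_div_sq H.pos H.tendsto_zero hh2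
  have hlev := hof H.level
  -- The exponent is `-(r-ρn)h - (r-ρ²n)h²/2` plus the two remainders. Writing `r - ρ²n = (r-ρn) +
  -- ρ(1-ρ)n`, only the second summand survives in the quadratic coefficient, with limit `32`,
  -- whence `-16ζ²`.
  have hlim := (((hlev.mul hh).neg.sub (((hlev.mul ((hof H.tendsto_zero).pow 2)).add
    (hof H.time)).mul ((hh.pow 2).div_const 2))).add ((hof H.tendsto_level).mul R1)).sub
    ((hof H.tendsto_time).mul R2)
  have hval : -(((4 * η : ℝ) : ℂ) * ζ) - (((4 * η : ℝ) : ℂ) * ((0 : ℝ) : ℂ) ^ 2 + ((32 : ℝ) : ℂ)) *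
      (ζ ^ 2 / 2) + ((ρ * (32 / (ρ * (1 - ρ))) : ℝ) : ℂ) * 0 -
      ((32 / (ρ * (1 - ρ)) : ℝ) : ℂ) * 0 = -(4 * η * ζ) - 16 * ζ ^ 2 := by
    push_cast; ring
  rw [hval] at hlim
  have hne : ∀ {g : ℕ → ℂ}, Tendsto g atTop (𝓝 0) → ∀ᶠ N in atTop, 1 + g N ≠ 0 := by
    intro g hg
    have : Tendsto (fun N => 1 + g N) atTop (𝓝 (1 + 0)) := hg.const_add 1
    exact this.eventually_ne (by simp)
  refine ((Complex.continuous_exp.tendsto _).comp hlim).congr' ?_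
  filter_upwards [hne z1, hne z2, H.pos] with N n1 n2 hpos
  have hl0 : (l N : ℂ) ≠ 0 := by exact_mod_cast hpos.ne'
  have e1 : (1 - h N) ^ r N = Complex.exp (r N * Complex.log (1 + -h N)) := by
    rw [Complex.exp_nat_mul, Complex.exp_log n1, sub_eq_add_neg]
  have e2 : (1 - ρ * h N) ^ n N = Complex.exp (n N * Complex.log (1 + -(ρ * h N))) := by
    rw [Complex.exp_nat_mul, Complex.exp_log n2, sub_eq_add_neg]
  simp only [Function.comp]
  rw [e1, e2, ← Complex.exp_sub]
  congr 1
  generalize Complex.log (1 + -h N) = L1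
  generalize Complex.log (1 + -(ρ * h N)) = L2
  push_cast
  field_simp
  ring

theorem tendsto_div_of_hasDerivAt {f : ℝ → ℂ} {f' : ℂ} (hf : HasDerivAt f f' 0) (h0 : f 0 = 0)
    {l : ℕ → ℝ} (hpos : ∀ᶠ N in atTop, 0 < l N) (hl : Tendsto l atTop (𝓝 0)) :
    Tendsto (fun N => f (l N) / (l N : ℂ)) atTop (𝓝 f') := by
  have h := hf.tendsto_slope_zero_right
  have hl' : Tendsto l atTop (𝓝[>] 0) :=
    tendsto_nhdsWithin_iff.2 ⟨hl, hpos⟩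
  refine (h.comp hl').congr fun N => ?_
  simp only [Function.comp, zero_add, h0, sub_zero, Complex.real_smul, Complex.ofReal_inv]
  rw [div_eq_inv_mul]

theorem tendsto_sin_sq_div {l : ℕ → ℝ} (hpos : ∀ᶠ N in atTop, 0 < l N)
    (hl : Tendsto l atTop (𝓝 0)) (ξ : ℝ) :
    Tendsto (fun N => ((Real.sin (l N * ξ / 2) ^ 2 : ℝ) : ℂ) / (l N : ℂ) ^ 2) atTop
      (𝓝 ((ξ : ℂ) ^ 2 / 4)) := by
  have hd : HasDerivAt (fun x : ℝ => ((Real.sin (x * ξ / 2) : ℝ) : ℂ)) (((ξ / 2 : ℝ) : ℂ)) 0 := by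
    have := (((hasDerivAt_id (0 : ℝ)).mul_const ξ).div_const 2).sin
    simp only [id, zero_mul, zero_div, Real.cos_zero, one_mul] at this
    exact this.ofReal_comp
  have := (tendsto_div_of_hasDerivAt hd (by simp) hpos hl).pow 2
  have e : (((ξ / 2 : ℝ) : ℂ)) ^ 2 = (ξ : ℂ) ^ 2 / 4 := by push_cast; ring
  rw [e] at this
  exact this.congr fun N => by rw [div_pow]; push_cast; rfl

theorem hasDerivAt_circlePt (b : Bool) (c : ℝ) :
    HasDerivAt (fun x : ℝ => circlePt b (x * c)) (-(rayDir b ^ 2 * c)) 0 := by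
  have h : HasDerivAt (fun x : ℝ => ((x * c : ℝ) : ℂ)) (c : ℂ) 0 := by
    simpa using ((hasDerivAt_id (0 : ℝ)).mul_const c).ofReal_comp
  have := ((h.const_mul (rayDir b ^ 2)).neg).cexp
  refine this.congr_deriv ?_
  simp

theorem tendsto_sq_pos {l : ℕ → ℝ} (hpos : ∀ᶠ N in atTop, 0 < l N)
    (hl : Tendsto l atTop (𝓝 0)) :
    (∀ᶠ N in atTop, 0 < l N ^ 2) ∧ Tendsto (fun N => l N ^ 2) atTop (𝓝 0) :=
  ⟨hpos.mono fun N hN => by positivity, by simpa using hl.pow 2⟩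

theorem tendsto_one_sub_circlePt_div (b : Bool) (c : ℝ) {l : ℕ → ℝ}
    (hpos : ∀ᶠ N in atTop, 0 < l N) (hl : Tendsto l atTop (𝓝 0)) :
    Tendsto (fun N => (1 - circlePt b (l N ^ 2 * c)) / (l N : ℂ) ^ 2) atTop
      (𝓝 (rayDir b ^ 2 * c)) := by
  obtain ⟨hp, hz⟩ := tendsto_sq_pos hpos hl
  have h := tendsto_div_of_hasDerivAt (f := fun x : ℝ => 1 - circlePt b (x * c))
    ((hasDerivAt_circlePt b c).const_sub 1) (by simp [circlePt]) hp hz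
  rw [neg_neg] at h
  exact h.congr fun N => by push_cast; rfl

theorem tendsto_circlePt (b : Bool) (c : ℝ) {l : ℕ → ℝ} (hl : Tendsto l atTop (𝓝 0)) :
    Tendsto (fun N => circlePt b (l N ^ 2 * c)) atTop (𝓝 1) := by
  have hc : Continuous (fun x : ℝ => circlePt b (x ^ 2 * c)) := by
    unfold circlePt; fun_prop
  have h0 : circlePt b (0 ^ 2 * c) = 1 := by simp [circlePt]
  have := (hc.tendsto 0).comp hl
  rw [h0] at this
  exact this

theorem tendsto_circleRoot_div (b : Bool) (t : ℝ) (ht : 0 < t) {l : ℕ → ℝ}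
    (hpos : ∀ᶠ N in atTop, 0 < l N) (hl : Tendsto l atTop (𝓝 0)) :
    Tendsto (fun N => circleRoot b (l N ^ 2 * t ^ 2 / 4) / (l N : ℂ)) atTop
      (𝓝 (rayDir b * t / 2)) := by
  obtain ⟨hp, hz⟩ := tendsto_sq_pos hpos hl
  have hd : HasDerivAt (fun x : ℝ => 2 * Real.sin (x * (t ^ 2 / 8))) (t ^ 2 / 4) 0 := by
    have := (((hasDerivAt_id (0 : ℝ)).mul_const (t ^ 2 / 8)).sin).const_mul 2
    simp only [id, zero_mul, Real.cos_zero, one_mul] at this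
    exact this.congr_deriv (by ring)
  have h1 : Tendsto (fun N => 2 * Real.sin (l N ^ 2 * (t ^ 2 / 8)) / l N ^ 2) atTop
      (𝓝 (t ^ 2 / 4)) := by
    have hl' : Tendsto (fun N => l N ^ 2) atTop (𝓝[>] 0) := tendsto_nhdsWithin_iff.2 ⟨hz, hp⟩
    refine (hd.tendsto_slope_zero_right.comp hl').congr fun N => ?_
    simp [div_eq_inv_mul]
  have h2 := (Real.continuous_sqrt.tendsto _).comp h1
  have e : Real.sqrt (t ^ 2 / 4) = t / 2 := by
    rw [show t ^ 2 / 4 = (t / 2) ^ 2 by ring, Real.sqrt_sq (by positivity)]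
  rw [e] at h2
  have h3 := ((((Complex.continuous_ofReal.tendsto _).comp h2).mul_const (rayDir b))).mul
    (tendsto_circlePt b (t ^ 2 / 16) hl)
  have e2 : ((t / 2 : ℝ) : ℂ) * rayDir b * 1 = rayDir b * t / 2 := by push_cast; ring
  rw [e2] at h3
  refine h3.congr' (hpos.mono fun N hN => ?_)
  simp only [Function.comp, circleRoot]
  rw [Real.sqrt_div' _ (by positivity), Real.sqrt_sq hN.le,
    show l N ^ 2 * t ^ 2 / 4 / 4 = l N ^ 2 * (t ^ 2 / 16) by ring,
    show l N ^ 2 * t ^ 2 / 4 / 2 = l N ^ 2 * (t ^ 2 / 8) by ring]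
  push_cast
  ring

theorem tendsto_circleJacobi (b : Bool) (t σ : ℝ) (ht : 0 < t) {l : ℕ → ℝ}
    (hpos : ∀ᶠ N in atTop, 0 < l N) (hl : Tendsto l atTop (𝓝 0)) {k : ℕ → ℕ}
    (hk : Tendsto (fun N => (k N : ℝ) * (l N / 2)) atTop (𝓝 σ)) :
    Tendsto (fun N => circleJacobi (k N) b (l N ^ 2 * t ^ 2 / 4)) atTop
      (𝓝 (Complex.cos (σ * (t * rayDir b)))) := by
  have hlC : Tendsto (fun N => (l N : ℂ)) atTop (𝓝 0) := by
    simpa [Function.comp_def] using (Complex.continuous_ofReal.tendsto 0).comp hl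
  have hkC : Tendsto (fun N => (k N : ℂ) * (l N / 2)) atTop (𝓝 (σ : ℂ)) := by
    have := (Complex.continuous_ofReal.tendsto _).comp hk
    refine this.congr fun N => ?_
    simp
  have hS := tendsto_circleRoot_div b t ht hpos hl
  have hH : Tendsto (fun N => (circlePt b (l N ^ 2 * t ^ 2 / 4 / 2) - 1) / (l N : ℂ)) atTop
      (𝓝 0) := by
    have := ((tendsto_one_sub_circlePt_div b (t ^ 2 / 8) hpos hl).mul hlC).neg
    rw [mul_zero, neg_zero] at this
    refine this.congr' (hpos.mono fun N hN => ?_)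
    have : (l N : ℂ) ≠ 0 := by exact_mod_cast hN.ne'
    beta_reduce
    rw [show l N ^ 2 * t ^ 2 / 4 / 2 = l N ^ 2 * (t ^ 2 / 8) by ring]
    field_simp
    ring
  -- The base is `1 + j·rayDir b·t·l/2 + o(l)`, because `circlePt` differs from `1` only by `O(l²)`.
  -- The cases `j = ±i` give the two exponentials of the cosine.
  have key : ∀ j : ℂ, Tendsto (fun N => (circlePt b (l N ^ 2 * t ^ 2 / 4 / 2) +
      j * circleRoot b (l N ^ 2 * t ^ 2 / 4)) ^ k N) atTop
      (𝓝 (Complex.exp (j * (σ * (t * rayDir b))))) := by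
    intro j
    have hg : Tendsto (fun N => ((circlePt b (l N ^ 2 * t ^ 2 / 4 / 2) - 1) +
        j * circleRoot b (l N ^ 2 * t ^ 2 / 4)) / (l N : ℂ)) atTop
        (𝓝 (0 + j * (rayDir b * t / 2))) :=
      (hH.add (hS.const_mul j)).congr fun N => by ring
    have hg0 := hg.mul hlC
    rw [mul_zero] at hg0
    have hg1 := (hkC.mul hg).mul_const 2
    have e : (σ : ℂ) * (0 + j * (rayDir b * t / 2)) * 2 = j * (σ * (t * rayDir b)) := by ring
    rw [e] at hg1
    refine (tendsto_one_add_pow_exp (k := k) hg0 ?_).congr' (hpos.mono fun N hN => ?_)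
    · refine hg1.congr fun N => by ring
    · have : (l N : ℂ) ≠ 0 := by exact_mod_cast hN.ne'
      rw [div_mul_cancel₀ _ this]
      congr 1
      ring
  have h := ((key Complex.I).add (key (-Complex.I))).div_const 2
  rw [Complex.cos]
  have e1 : Complex.I * (σ * (t * rayDir b)) = σ * (t * rayDir b) * Complex.I := by ring
  have e2 : -Complex.I * (σ * (t * rayDir b)) = -(σ * (t * rayDir b)) * Complex.I := by ring
  rw [e1, e2] at h
  refine h.congr fun N => ?_
  rw [circleJacobi, neg_mul, ← sub_eq_add_neg]

theorem IsScaling.tendsto_lineFactor {ρ η σ ξ : ℝ} {l : ℕ → ℝ} {n r k : ℕ → ℕ} (e : ℕ)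
    (H : IsScaling ρ η l n r) (hk : Tendsto (fun N => (k N : ℝ) * (l N / 2)) atTop (𝓝 σ)) :
    Tendsto (fun N => (lineFactor ρ (n N) (r N) e (k N) (l N * ξ) : ℂ)) atTop
      (𝓝 (Complex.exp (-η * ξ ^ 2 - ξ ^ 4) * Complex.cos (σ * ξ))) := by
  have h1 := H.tendsto_pow_div_pow (tendsto_sin_sq_div H.pos H.tendsto_zero ξ)
  have h2 : Tendsto (fun N => ((Real.cos (l N * ξ / 2) ^ e : ℝ) : ℂ)) atTop (𝓝 1) := by
    have hc : Continuous (fun x : ℝ => ((Real.cos (x * ξ / 2) ^ e : ℝ) : ℂ)) := by fun_prop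
    have := (hc.tendsto 0).comp H.tendsto_zero
    simpa [Function.comp_def] using this
  have h3 : Tendsto (fun N => ((Real.cos (k N * (l N * ξ / 2)) : ℝ) : ℂ)) atTop
      (𝓝 (Complex.cos (σ * ξ))) := by
    have hc : Continuous (fun x : ℝ => ((Real.cos (x * ξ) : ℝ) : ℂ)) := by fun_prop
    have := (hc.tendsto σ).comp hk
    have e1 : ((Real.cos (σ * ξ) : ℝ) : ℂ) = Complex.cos (σ * ξ) := by push_cast; rfl
    rw [e1] at this
    refine this.congr fun N => ?_
    simp only [Function.comp]
    congr 2
    ring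
  have h := (h1.mul h2).mul h3
  have e1 : Complex.exp (-(4 * η * ((ξ : ℂ) ^ 2 / 4)) - 16 * ((ξ : ℂ) ^ 2 / 4) ^ 2) * 1 *
      Complex.cos (σ * ξ) = Complex.exp (-η * ξ ^ 2 - ξ ^ 4) * Complex.cos (σ * ξ) := by
    rw [mul_one]; congr 2; ring
  rw [e1] at h
  refine h.congr fun N => ?_
  have hc : Complex.cos (l N * ξ / 2) ^ 2 = 1 - Complex.sin (l N * ξ / 2) ^ 2 :=
    Complex.cos_sq' _
  rw [lineFactor]
  push_cast
  rw [pow_add, pow_mul, hc]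
  ring

theorem IsScaling.tendsto_circleFactor {ρ η σ t : ℝ} (ht : 0 < t) {l : ℕ → ℝ} {n r k : ℕ → ℕ}
    (e : ℕ) (b : Bool) (H : IsScaling ρ η l n r)
    (hk : Tendsto (fun N => (k N : ℝ) * (l N / 2)) atTop (𝓝 σ)) :
    Tendsto (fun N => circleFactor ρ (n N) (r N) e (k N) b (l N ^ 2 * t ^ 2 / 4)) atTop
      (𝓝 (Complex.exp (η * (t * rayDir b) ^ 2 + (t * rayDir b) ^ 4) *
        Complex.cos (σ * (t * rayDir b)))) := by
  have h0 := tendsto_one_sub_circlePt_div b (t ^ 2 / 4) H.pos H.tendsto_zero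
  have h1 := (H.tendsto_pow_div_pow h0).inv₀ (Complex.exp_ne_zero _)
  rw [← Complex.exp_neg] at h1
  have h2 := tendsto_circlePt b (t ^ 2 / 4) H.tendsto_zero
  have h3 := (tendsto_circlePt b (t ^ 2 / 8) H.tendsto_zero).pow e
  have h4 := tendsto_circleJacobi b t σ ht H.pos H.tendsto_zero hk
  have h := h1.mul ((h2.mul h4).div h3 (by simp))
  have e1 : -(-(4 * η * (rayDir b ^ 2 * ((t ^ 2 / 4 : ℝ) : ℂ))) -
      16 * (rayDir b ^ 2 * ((t ^ 2 / 4 : ℝ) : ℂ)) ^ 2) =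
      η * (t * rayDir b) ^ 2 + (t * rayDir b) ^ 4 := by
    push_cast; ring
  rw [e1, one_pow, div_one, one_mul] at h
  refine h.congr fun N => ?_
  simp only [Pi.div_apply]
  rw [circleFactor, show l N ^ 2 * (t ^ 2 / 4) = l N ^ 2 * t ^ 2 / 4 by ring,
    show l N ^ 2 * (t ^ 2 / 8) = l N ^ 2 * t ^ 2 / 4 / 2 by ring, inv_div]
  congr 3
  · ring
  · ring

theorem rayDir_sq_mul_ne (b : Bool) {t ξ : ℝ} (ht : 0 < t) :
    (ξ : ℂ) ^ 2 - (t * rayDir b) ^ 2 ≠ 0 := by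
  intro h
  have := congrArg Complex.im h
  rw [mul_pow, rayDir_sq] at this
  cases b <;> simp [← Complex.ofReal_pow] at this <;> exact ht.ne' this

/-- The denominator is `sin²(lξ/2) - (1 - circlePt)`, a difference of two quantities of order `l²`,
matched by the factor `l²` that the substitution puts in the numerator. -/
theorem tendsto_cauchy_factor (b : Bool) {ξ t : ℝ} (ht : 0 < t) {l : ℕ → ℝ}
    (hpos : ∀ᶠ N in atTop, 0 < l N) (hl : Tendsto l atTop (𝓝 0)) :
    Tendsto (fun N => ((l N ^ 2 * t : ℝ) : ℂ) /
      (circlePt b (l N ^ 2 * t ^ 2 / 4) - (Real.cos (l N * ξ / 2) ^ 2 : ℝ))) atTop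
      (𝓝 (4 * t / ((ξ : ℂ) ^ 2 - (t * rayDir b) ^ 2))) := by
  have h1 := (tendsto_sin_sq_div hpos hl ξ).sub (tendsto_one_sub_circlePt_div b (t ^ 2 / 4) hpos hl)
  have hne := rayDir_sq_mul_ne b (ξ := ξ) ht
  have e1 : (ξ : ℂ) ^ 2 / 4 - rayDir b ^ 2 * ((t ^ 2 / 4 : ℝ) : ℂ) =
      ((ξ : ℂ) ^ 2 - (t * rayDir b) ^ 2) / 4 := by push_cast; ring
  rw [e1] at h1
  have h2 := (h1.inv₀ (div_ne_zero hne (by norm_num))).const_mul (t : ℂ)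
  have e2 : (t : ℂ) * (((ξ : ℂ) ^ 2 - (t * rayDir b) ^ 2) / 4)⁻¹ =
      4 * t / ((ξ : ℂ) ^ 2 - (t * rayDir b) ^ 2) := by
    rw [inv_div]; ring
  rw [e2] at h2
  refine h2.congr' (hpos.mono fun N hN => ?_)
  have hl0 : (l N : ℂ) ≠ 0 := by exact_mod_cast hN.ne'
  beta_reduce
  rw [show l N ^ 2 * (t ^ 2 / 4) = l N ^ 2 * t ^ 2 / 4 by ring, ← sub_div, inv_div, Real.cos_sq']
  push_cast
  rw [show Complex.sin (l N * ξ / 2) ^ 2 - (1 - circlePt b (l N ^ 2 * t ^ 2 / 4)) =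
    circlePt b (l N ^ 2 * t ^ 2 / 4) - (1 - Complex.sin (l N * ξ / 2) ^ 2) by ring]
  ring

/-! ### Bounds uniform in the scaling parameter -/

theorem quartic_bounded_above {a : ℝ} (ha : 0 < a) (b c : ℝ) :
    ∃ C : ℝ, ∀ x : ℝ, -(a * x ^ 4) + b * x ^ 2 + c * x ≤ C := by
  refine ⟨(b + 1 / 2) ^ 2 / (4 * a) + c ^ 2 / 2, fun x => ?_⟩
  have h1 : c * x ≤ (c ^ 2 + x ^ 2) / 2 := by nlinarith [sq_nonneg (c - x)]
  have h2 : -(a * x ^ 4) + (b + 1 / 2) * x ^ 2 ≤ (b + 1 / 2) ^ 2 / (4 * a) := by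
    rw [le_div_iff₀ (by positivity)]
    nlinarith [sq_nonneg (2 * a * x ^ 2 - (b + 1 / 2))]
  linarith

/-- The gap between the two sides vanishes at `h = 0` and has derivative `p(1-p)h(1/((1-ph)(1-h)) -
1) ≥ 0`. This is the quadratic expansion made into an inequality valid up to `h = 1`. -/
theorem mul_log_one_sub_le {p h : ℝ} (hp : 0 < p) (hp1 : p < 1) (h0 : 0 ≤ h) (h1 : h < 1) :
    p * Real.log (1 - h) ≤ Real.log (1 - p * h) - p * (1 - p) / 2 * h ^ 2 := by
  have hd : ∀ x ∈ Ico (0 : ℝ) 1, HasDerivAt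
      (fun x => Real.log (1 - p * x) - p * (1 - p) / 2 * x ^ 2 - p * Real.log (1 - x))
      (p * (1 - p) * x * (((1 - p * x) * (1 - x))⁻¹ - 1)) x := by
    intro x hx
    have e1 : 0 < 1 - x := by linarith [hx.2]
    have e2 : 0 < 1 - p * x := by nlinarith [hx.1, hx.2]
    have d1 := (((hasDerivAt_id x).const_mul p).const_sub 1).log e2.ne'
    have d2 := ((hasDerivAt_id x).const_sub 1).log e1.ne'
    have d3 := (hasDerivAt_pow 2 x).const_mul (p * (1 - p) / 2)
    refine ((d1.sub d3).sub (d2.const_mul p)).congr_deriv ?_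
    simp only [id, mul_one]
    push_cast
    field_simp
    ring
  have hmono : MonotoneOn
      (fun x => Real.log (1 - p * x) - p * (1 - p) / 2 * x ^ 2 - p * Real.log (1 - x))
      (Ico 0 1) := by
    refine monotoneOn_of_deriv_nonneg (convex_Ico 0 1)
      (fun x hx => (hd x hx).continuousAt.continuousWithinAt)
      (fun x hx => (hd x (interior_subset hx)).differentiableAt.differentiableWithinAt) ?_
    intro x hx
    have hx' := interior_subset hx
    rw [(hd x hx').deriv]
    have e1 : 0 < 1 - x := by linarith [hx'.2]
    have e2 : 0 < 1 - p * x := by nlinarith [hx'.1, hx'.2]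
    have e3 : (1 - p * x) * (1 - x) ≤ 1 :=
      mul_le_one₀ (by nlinarith [hx'.1]) e1.le (by linarith [hx'.1])
    have e4 : 1 ≤ ((1 - p * x) * (1 - x))⁻¹ := (one_le_inv₀ (by positivity)).2 e3
    exact mul_nonneg (mul_nonneg (mul_nonneg hp.le (by linarith)) hx'.1) (by linarith)
  have := hmono (left_mem_Ico.2 one_pos) ⟨h0, h1⟩ h0
  simp at this
  linarith

/-- For `p = r/n` in place of `ρ` the linear term cancels exactly, and `mul_log_one_sub_le` gives
the quadratic decay. Replacing `p` by `ρ` costs at most `n|p-ρ|h/(1-ρ)`, by `log y ≤ y - 1`. -/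
theorem pow_div_pow_le {ρ h : ℝ} (hρ : 0 < ρ) (hρ1 : ρ < 1) (h0 : 0 ≤ h) (h1 : h < 1)
    {n r : ℕ} (hr : 0 < r) (hrn : r < n) :
    (1 - h) ^ r / (1 - ρ * h) ^ n ≤
      Real.exp (-((n : ℝ) * ((r : ℝ) / n * (1 - (r : ℝ) / n)) / 2 * h ^ 2) +
        |(r : ℝ) - ρ * n| * h / (1 - ρ)) := by
  have hn : (0 : ℝ) < n := by exact_mod_cast hr.trans hrn
  have hr' : (0 : ℝ) < r := by exact_mod_cast hr
  set p : ℝ := r / n with hp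
  have hp0 : 0 < p := by positivity
  have hp1 : p < 1 := (div_lt_one hn).2 (by exact_mod_cast hrn)
  have hrp : (r : ℝ) = n * p := by rw [hp]; field_simp
  have e1 : 0 < 1 - h := by linarith
  have e2 : 0 < 1 - ρ * h := by nlinarith
  have e3 : 0 < 1 - p * h := by nlinarith
  have key := mul_log_one_sub_le hp0 hp1 h0 h1
  have hlog : Real.log (1 - p * h) - Real.log (1 - ρ * h) ≤ |p - ρ| * h / (1 - ρ) := by
    rw [← Real.log_div e3.ne' e2.ne']
    refine (Real.log_le_sub_one_of_pos (div_pos e3 e2)).trans ?_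
    rw [div_sub_one e2.ne']
    have h3 : 1 - p * h - (1 - ρ * h) ≤ |p - ρ| * h := by
      nlinarith [neg_abs_le (p - ρ)]
    have h4 : 1 - ρ ≤ 1 - ρ * h := by nlinarith
    calc (1 - p * h - (1 - ρ * h)) / (1 - ρ * h) ≤ |p - ρ| * h / (1 - ρ * h) := by gcongr
      _ ≤ |p - ρ| * h / (1 - ρ) := by gcongr
  have habs : |(r : ℝ) - ρ * n| = n * |p - ρ| := by
    rw [hrp, ← abs_of_pos hn, ← abs_mul, abs_of_pos hn]; ring_nf
  rw [← Real.exp_log (pow_pos e1 r), ← Real.exp_log (pow_pos e2 n), ← Real.exp_sub,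
    Real.log_pow, Real.log_pow, habs]
  refine Real.exp_le_exp.2 ?_
  rw [hrp]
  have := mul_le_mul_of_nonneg_left key hn.le
  have := mul_le_mul_of_nonneg_left hlog hn.le
  have e : (n : ℝ) * |p - ρ| * h / (1 - ρ) = n * (|p - ρ| * h / (1 - ρ)) := by ring
  rw [e]
  nlinarith

theorem sin_sq_half_bounds {y : ℝ} (h0 : 0 ≤ y) (h1 : y ≤ Real.pi) :
    y ^ 2 / Real.pi ^ 2 ≤ Real.sin (y / 2) ^ 2 ∧ Real.sin (y / 2) ^ 2 ≤ y ^ 2 / 4 := by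
  have hl := Real.mul_le_sin (x := y / 2) (by linarith) (by linarith)
  have hu := Real.sin_le (x := y / 2) (by linarith)
  have hs : 0 ≤ Real.sin (y / 2) := le_trans (by positivity) hl
  constructor
  · calc y ^ 2 / Real.pi ^ 2 = (2 / Real.pi * (y / 2)) ^ 2 := by field_simp
      _ ≤ _ := by gcongr
  · calc Real.sin (y / 2) ^ 2 ≤ (y / 2) ^ 2 := by gcongr
      _ = _ := by ring

theorem IsScaling.tendsto_ratio {ρ η : ℝ} {l : ℕ → ℝ} {n r : ℕ → ℕ} (H : IsScaling ρ η l n r) :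
    Tendsto (fun N => (r N : ℝ) / n N) atTop (𝓝 ρ) := by
  have h : ρ * (1 - ρ) ≠ 0 := (mul_pos H.rho_pos (sub_pos.2 H.rho_lt_one)).ne'
  have := H.tendsto_level.div H.tendsto_time (by positivity)
  rw [mul_div_cancel_right₀ _ (by positivity)] at this
  refine this.congr' (H.pos.mono fun N hN => ?_)
  simp only [Pi.div_apply]
  rw [mul_div_mul_right _ _ (by positivity)]

theorem IsScaling.lineFactor_le {ρ η : ℝ} {l : ℕ → ℝ} {n r : ℕ → ℕ} (e : ℕ) (k : ℕ → ℕ)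
    (H : IsScaling ρ η l n r) :
    ∃ C : ℝ, 0 ≤ C ∧ ∀ᶠ N in atTop, ∀ ξ ∈ Ioo 0 (Real.pi / l N),
      |lineFactor ρ (n N) (r N) e (k N) (l N * ξ)| ≤ C * Real.exp (-ξ) := by
  have hρ := H.rho_pos
  have hρ1 := sub_pos.2 H.rho_lt_one
  -- The quartic coefficient comes from `sin²(y/2) ≥ y²/π²` and `n l⁴ (r/n)(1-r/n) ≥ 16`, half of
  -- its limit; the quadratic one from `sin²(y/2) ≤ y²/4`. The linear coefficient `1` pays for the
  -- factor `exp(-ξ)`.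
  obtain ⟨C, hC⟩ := quartic_bounded_above (a := 8 / Real.pi ^ 4) (by positivity)
    ((4 * |η| + 1) / (4 * (1 - ρ))) 1
  refine ⟨Real.exp C, (Real.exp_pos _).le, ?_⟩
  have hratio := H.tendsto_ratio
  have h1 : ∀ᶠ N in atTop, 16 ≤
      (n N : ℝ) * l N ^ 4 * ((r N : ℝ) / n N * (1 - (r N : ℝ) / n N)) := by
    have := H.tendsto_time.mul (hratio.mul (hratio.const_sub 1))
    rw [div_mul_cancel₀ _ (by positivity)] at this
    exact this.eventually_const_le (by norm_num)
  have h2 : ∀ᶠ N in atTop, |(r N : ℝ) - ρ * n N| * l N ^ 2 ≤ 4 * |η| + 1 := by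
    have := H.level.abs
    rw [abs_mul, abs_of_pos (by norm_num : (0 : ℝ) < 4)] at this
    filter_upwards [this.eventually_le_const (lt_add_one _)] with N hN
    rwa [abs_mul, abs_of_nonneg (sq_nonneg (l N) : 0 ≤ l N ^ 2)] at hN
  filter_upwards [H.pos, h1, h2, hratio.eventually_const_lt H.rho_pos,
    hratio.eventually_lt_const H.rho_lt_one] with N hl g1 g2 g3 g4 ξ hξ
  have hn : 0 < n N := by
    rcases Nat.eq_zero_or_pos (n N) with h | h
    · simp [h] at g3
    · exact h
  have hr : 0 < r N := by
    rcases Nat.eq_zero_or_pos (r N) with h | h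
    · simp [h] at g3
    · exact h
  have hrn : r N < n N := by
    rw [div_lt_one (by exact_mod_cast hn)] at g4
    exact_mod_cast g4
  have hξ0 : 0 < ξ := hξ.1
  have hy1 : l N * ξ < Real.pi := by
    have := (lt_div_iff₀ hl).1 hξ.2
    linarith
  have hy0 : 0 < l N * ξ := mul_pos hl hξ0
  obtain ⟨b1, b2⟩ := sin_sq_half_bounds hy0.le hy1.le
  have hc : 0 < Real.cos (l N * ξ / 2) :=
    Real.cos_pos_of_mem_Ioo ⟨by linarith [Real.pi_pos], by linarith⟩
  have hcs := Real.sin_sq_add_cos_sq (l N * ξ / 2)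
  set h := Real.sin (l N * ξ / 2) ^ 2 with hh
  have hc2 : Real.cos (l N * ξ / 2) ^ 2 = 1 - h := by linarith
  have hh0 : 0 ≤ h := sq_nonneg _
  have hh1 : h < 1 := by nlinarith [pow_pos hc 2]
  have hden : 0 < 1 - ρ * h := by nlinarith [H.rho_lt_one]
  have hmain := pow_div_pow_le hρ H.rho_lt_one hh0 hh1 hr hrn
  have hle : |lineFactor ρ (n N) (r N) e (k N) (l N * ξ)| ≤ (1 - h) ^ r N / (1 - ρ * h) ^ n N := by
    rw [lineFactor, abs_mul, abs_div, abs_of_pos (pow_pos hden _), abs_of_pos (pow_pos hc _),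
      pow_add, pow_mul, hc2]
    have hce : Real.cos (l N * ξ / 2) ^ e ≤ 1 := pow_le_one₀ hc.le (Real.cos_le_one _)
    have : (0 : ℝ) ≤ (1 - h) ^ r N := pow_nonneg (by linarith) _
    calc _ ≤ (1 - h) ^ r N * 1 / (1 - ρ * h) ^ n N * 1 := by
          gcongr
          exact Real.abs_cos_le_one _
      _ = _ := by ring
  refine hle.trans (hmain.trans ?_)
  rw [← Real.exp_add]
  refine Real.exp_le_exp.2 ?_
  have hp : (0 : ℝ) ≤ (n N : ℝ) * ((r N : ℝ) / n N * (1 - (r N : ℝ) / n N)) :=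
    mul_nonneg (Nat.cast_nonneg _) (mul_nonneg g3.le (by linarith))
  have i1 : 8 / Real.pi ^ 4 * ξ ^ 4 ≤
      (n N : ℝ) * ((r N : ℝ) / n N * (1 - (r N : ℝ) / n N)) / 2 * h ^ 2 := by
    calc 8 / Real.pi ^ 4 * ξ ^ 4 = 16 * (ξ ^ 4 / (2 * Real.pi ^ 4)) := by ring
      _ ≤ (n N : ℝ) * l N ^ 4 * ((r N : ℝ) / n N * (1 - (r N : ℝ) / n N)) *
          (ξ ^ 4 / (2 * Real.pi ^ 4)) := by gcongr
      _ = (n N : ℝ) * ((r N : ℝ) / n N * (1 - (r N : ℝ) / n N)) / 2 *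
          ((l N * ξ) ^ 2 / Real.pi ^ 2) ^ 2 := by field_simp
      _ ≤ _ := by gcongr
  have i2 : |(r N : ℝ) - ρ * n N| * h / (1 - ρ) ≤ (4 * |η| + 1) / (4 * (1 - ρ)) * ξ ^ 2 := by
    calc |(r N : ℝ) - ρ * n N| * h / (1 - ρ)
        ≤ |(r N : ℝ) - ρ * n N| * ((l N * ξ) ^ 2 / 4) / (1 - ρ) := by gcongr
      _ = |(r N : ℝ) - ρ * n N| * l N ^ 2 * (ξ ^ 2 / (4 * (1 - ρ))) := by field_simp
      _ ≤ (4 * |η| + 1) * (ξ ^ 2 / (4 * (1 - ρ))) := by gcongr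
      _ = _ := by ring
  have := hC ξ
  linarith

theorem circlePt_re (b : Bool) (ψ : ℝ) : (circlePt b ψ).re = Real.cos ψ := by
  rw [circlePt, rayDir_sq, Complex.exp_re]
  cases b <;> simp

theorem normSq_circlePt (b : Bool) (ψ : ℝ) : (circlePt b ψ).re ^ 2 + (circlePt b ψ).im ^ 2 = 1 := by
  have := Complex.sq_norm (circlePt b ψ)
  rw [norm_circlePt, Complex.normSq_apply] at this
  linarith

/-- The squared modulus is `1 - 2ρ(1-ρ)(1 - cos ψ)`. It is the only source of decay on the circle,
where the powers of `circlePt` have modulus one. -/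
theorem norm_one_sub_add_circlePt_le {ρ : ℝ} (h0 : 0 < ρ) (h1 : ρ < 1) (b : Bool) {ψ : ℝ}
    (hψ : |ψ| ≤ Real.pi) :
    ‖(1 - ρ : ℂ) + ρ * circlePt b ψ‖ ≤ Real.exp (-(2 * (ρ * (1 - ρ)) / Real.pi ^ 2 * ψ ^ 2)) := by
  have hsq : ‖(1 - ρ : ℂ) + ρ * circlePt b ψ‖ ^ 2 = 1 - 2 * (ρ * (1 - ρ)) * (1 - Real.cos ψ) := by
    rw [Complex.sq_norm, Complex.normSq_apply, ← circlePt_re b ψ]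
    have := normSq_circlePt b ψ
    simp
    linear_combination ρ ^ 2 * this
  have hcos := Real.cos_le_one_sub_mul_cos_sq hψ
  have hρ : 0 < ρ * (1 - ρ) := mul_pos h0 (by linarith)
  refine (pow_le_pow_iff_left₀ (norm_nonneg _) (Real.exp_pos _).le two_ne_zero).1 ?_
  rw [hsq, ← Real.exp_nat_mul]
  refine le_trans ?_ (Real.add_one_le_exp _)
  have : 2 * (ρ * (1 - ρ)) * (2 / Real.pi ^ 2 * ψ ^ 2) ≤ 2 * (ρ * (1 - ρ)) * (1 - Real.cos ψ) := by
    gcongr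
    linarith
  push_cast
  linarith [show 2 * (ρ * (1 - ρ)) * (2 / Real.pi ^ 2 * ψ ^ 2) =
    2 * (2 * (ρ * (1 - ρ)) / Real.pi ^ 2 * ψ ^ 2) by ring]

theorem norm_circleJacobi_le (k : ℕ) (b : Bool) {ψ : ℝ} (hψ : 0 ≤ ψ) :
    ‖circleJacobi k b ψ‖ ≤ Real.exp (k * Real.sqrt ψ) := by
  have hS := norm_circleRoot_le b ψ hψ
  have h1 : ‖circlePt b (ψ / 2) + Complex.I * circleRoot b ψ‖ ≤ Real.exp (Real.sqrt ψ) := by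
    refine (norm_add_le _ _).trans ?_
    rw [norm_mul, Complex.norm_I, norm_circlePt, one_mul]
    linarith [Real.add_one_le_exp (Real.sqrt ψ)]
  have h2 : ‖circlePt b (ψ / 2) - Complex.I * circleRoot b ψ‖ ≤ Real.exp (Real.sqrt ψ) := by
    refine (norm_sub_le _ _).trans ?_
    rw [norm_mul, Complex.norm_I, norm_circlePt, one_mul]
    linarith [Real.add_one_le_exp (Real.sqrt ψ)]
  have h3 := pow_le_pow_left₀ (norm_nonneg _) h1 k
  have h4 := pow_le_pow_left₀ (norm_nonneg _) h2 k
  rw [← Real.exp_nat_mul, ← norm_pow] at h3 h4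
  rw [circleJacobi, norm_div, Complex.norm_ofNat, div_le_iff₀ two_pos]
  refine (norm_add_le _ _).trans ?_
  linarith

theorem norm_circleFactor_le {ρ : ℝ} (h0 : 0 < ρ) (h1 : ρ < 1) (n r e k : ℕ) (b : Bool) {ψ : ℝ}
    (hψ0 : 0 ≤ ψ) (hψ : ψ ≤ Real.pi) :
    ‖circleFactor ρ n r e k b ψ‖ ≤
      Real.exp (-(2 * (n * (ρ * (1 - ρ))) / Real.pi ^ 2 * ψ ^ 2) + k * Real.sqrt ψ) := by
  have hb := pow_le_pow_left₀ (norm_nonneg _)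
    (norm_one_sub_add_circlePt_le h0 h1 b (abs_le.2 ⟨by linarith [Real.pi_pos], hψ⟩)) n
  rw [← Real.exp_nat_mul] at hb
  rw [circleFactor, norm_mul, norm_div, norm_div, norm_mul, norm_pow, norm_pow, norm_pow,
    norm_circlePt, norm_circlePt, one_pow, one_pow, div_one, div_one, one_mul, Real.exp_add]
  refine mul_le_mul (hb.trans_eq ?_) (norm_circleJacobi_le k b hψ0) (norm_nonneg _)
    (Real.exp_pos _).le
  congr 1
  ring

theorem mem_circle_range {l t : ℝ} (hl : 0 < l) (ht : t ∈ Ioo 0 (2 * Real.sqrt Real.pi / l)) :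
    0 ≤ l ^ 2 * t ^ 2 / 4 ∧ l ^ 2 * t ^ 2 / 4 ≤ Real.pi := by
  refine ⟨by positivity, ?_⟩
  have h2 := (lt_div_iff₀ hl).1 ht.2
  have h1 := ht.1
  have h3 : (t * l) ^ 2 ≤ (2 * Real.sqrt Real.pi) ^ 2 := by gcongr
  rw [mul_pow 2, Real.sq_sqrt Real.pi_pos.le] at h3
  linarith

theorem IsScaling.circleFactor_le {ρ η σ : ℝ} {l : ℕ → ℝ} {n r k : ℕ → ℕ} (e : ℕ) (b : Bool)
    (H : IsScaling ρ η l n r) (hk : Tendsto (fun N => (k N : ℝ) * (l N / 2)) atTop (𝓝 σ)) :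
    ∃ C : ℝ, 0 ≤ C ∧ ∀ᶠ N in atTop, ∀ t ∈ Ioo 0 (2 * Real.sqrt Real.pi / l N),
      ‖circleFactor ρ (n N) (r N) e (k N) b (l N ^ 2 * t ^ 2 / 4)‖ ≤ C * Real.exp (-t) := by
  -- No quadratic term arises, since the level `r` contributes only a phase. In `σ + 2`, the part `σ
  -- + 1` bounds the growth of the polynomial and the last `1` pays for `exp(-t)`.
  obtain ⟨C, hC⟩ := quartic_bounded_above (a := 2 / Real.pi ^ 2) (by positivity) 0 (σ + 2)
  refine ⟨Real.exp C, (Real.exp_pos _).le, ?_⟩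
  filter_upwards [H.pos, H.time.eventually_const_le (by norm_num : (16 : ℝ) < 32),
    hk.eventually_le_const (lt_add_one σ)] with N hl g1 g2 t ht
  obtain ⟨p0, p1⟩ := mem_circle_range hl ht
  have ht0 : 0 < t := ht.1
  refine (norm_circleFactor_le H.rho_pos H.rho_lt_one _ _ _ _ b p0 p1).trans ?_
  rw [← Real.exp_add]
  refine Real.exp_le_exp.2 ?_
  have hs : Real.sqrt (l N ^ 2 * t ^ 2 / 4) = l N / 2 * t := by
    rw [show l N ^ 2 * t ^ 2 / 4 = (l N / 2 * t) ^ 2 by ring, Real.sqrt_sq (by positivity)]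
  have i1 : 2 / Real.pi ^ 2 * t ^ 4 ≤
      2 * (n N * (ρ * (1 - ρ))) / Real.pi ^ 2 * (l N ^ 2 * t ^ 2 / 4) ^ 2 := by
    calc 2 / Real.pi ^ 2 * t ^ 4 = 16 * (t ^ 4 / (8 * Real.pi ^ 2)) := by ring
      _ ≤ (n N : ℝ) * l N ^ 4 * (ρ * (1 - ρ)) * (t ^ 4 / (8 * Real.pi ^ 2)) := by gcongr
      _ = _ := by ring
  have i2 : (k N : ℝ) * Real.sqrt (l N ^ 2 * t ^ 2 / 4) ≤ (σ + 1) * t := by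
    rw [hs, ← mul_assoc]
    gcongr
  have := hC t
  linarith

/-- The denominator is at least a multiple of `l²(ξ⁴ + t⁴)^(1/2)`, and `ξt³ ≤ ξ⁴ + t⁴` splits the
singularity at the origin into a product of two integrable inverse square roots. -/
theorem norm_cauchy_factor_le (b : Bool) {l ξ t : ℝ} (hl : 0 < l) (hξ : ξ ∈ Ioo 0 (Real.pi / l))
    (ht : t ∈ Ioo 0 (2 * Real.sqrt Real.pi / l)) :
    ‖((l ^ 2 * t : ℝ) : ℂ) / (circlePt b (l ^ 2 * t ^ 2 / 4) - (Real.cos (l * ξ / 2) ^ 2 : ℝ))‖ ≤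
      2 * Real.pi ^ 2 * ((Real.sqrt ξ)⁻¹ * (Real.sqrt t)⁻¹) := by
  obtain ⟨p0, p1⟩ := mem_circle_range hl ht
  have ht0 : 0 < t := ht.1
  have hξ0 : 0 < ξ := hξ.1
  have hy1 : l * ξ < Real.pi := by
    have := (lt_div_iff₀ hl).1 hξ.2
    linarith
  have hy0 : 0 < l * ξ := mul_pos hl hξ0
  obtain ⟨b1, -⟩ := sin_sq_half_bounds hy0.le hy1.le
  set ψ := l ^ 2 * t ^ 2 / 4 with hψ
  have hcs := Real.sin_sq_add_cos_sq (l * ξ / 2)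
  set a := Real.sin (l * ξ / 2) ^ 2 with ha
  have hc2 : Real.cos (l * ξ / 2) ^ 2 = 1 - a := by linarith
  have ha0 : 0 ≤ a := sq_nonneg _
  have ha1 : a ≤ 1 := by nlinarith [sq_nonneg (Real.cos (l * ξ / 2))]
  have hcos := Real.cos_le_one_sub_mul_cos_sq (x := ψ)
    (abs_le.2 ⟨by linarith [Real.pi_pos], p1⟩)
  set d := 1 - Real.cos ψ with hd
  have hd1 : 2 / Real.pi ^ 2 * ψ ^ 2 ≤ d := by linarith
  have hd0 : 0 ≤ d := by linarith [Real.cos_le_one ψ]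
  have hd2 : d ≤ 2 := by linarith [Real.neg_one_le_cos ψ]
  have hsq : ‖circlePt b ψ - (Real.cos (l * ξ / 2) ^ 2 : ℝ)‖ ^ 2 = a ^ 2 + 2 * (1 - a) * d := by
    rw [hc2, Complex.sq_norm, Complex.normSq_apply, hd, ← circlePt_re b ψ]
    have := normSq_circlePt b ψ
    simp only [Complex.sub_re, Complex.sub_im, Complex.ofReal_re, Complex.ofReal_im]
    linear_combination this
  -- The coefficient `1 - a` of `d` degenerates at the far end `a = 1`, but there `a²` is close to
  -- `1` and controls `d ≤ 2`.
  have hlow : a ^ 2 + d ≤ 3 * (a ^ 2 + 2 * (1 - a) * d) := by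
    nlinarith [mul_nonneg (sub_nonneg.2 ha1) hd0, mul_nonneg ha0 (sub_nonneg.2 hd2),
      mul_nonneg (sub_nonneg.2 ha1) (sub_nonneg.2 hd2), mul_nonneg (sub_nonneg.2 ha1) ha0]
  have hpi : 8 ≤ Real.pi ^ 2 := by nlinarith [Real.pi_gt_three]
  have hlow2 : l ^ 4 * (ξ ^ 4 + t ^ 4) ≤ Real.pi ^ 4 * (a ^ 2 + d) := by
    have i1 : l ^ 4 * ξ ^ 4 ≤ Real.pi ^ 4 * a ^ 2 := by
      have : ((l * ξ) ^ 2 / Real.pi ^ 2) ^ 2 ≤ a ^ 2 := by gcongr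
      rw [div_pow, div_le_iff₀ (by positivity)] at this
      nlinarith
    have i2 : l ^ 4 * t ^ 4 ≤ Real.pi ^ 4 * d := by
      calc l ^ 4 * t ^ 4 = 8 * (l ^ 4 * t ^ 4 / 8) := by ring
        _ ≤ Real.pi ^ 2 * (l ^ 4 * t ^ 4 / 8) := by gcongr
        _ = Real.pi ^ 4 * (2 / Real.pi ^ 2 * ψ ^ 2) := by rw [hψ]; field_simp; norm_num
        _ ≤ _ := by gcongr
    linarith
  have hyoung : ξ * t ^ 3 ≤ ξ ^ 4 + t ^ 4 := by
    rcases le_total ξ t with h | h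
    · have : ξ * t ^ 3 ≤ t * t ^ 3 := by gcongr
      have : 0 ≤ ξ ^ 4 := by positivity
      linarith [show t * t ^ 3 = t ^ 4 by ring]
    · have : ξ * t ^ 3 ≤ ξ * ξ ^ 3 := by gcongr
      have : 0 ≤ t ^ 4 := by positivity
      linarith [show ξ * ξ ^ 3 = ξ ^ 4 by ring]
  set D := ‖circlePt b ψ - (Real.cos (l * ξ / 2) ^ 2 : ℝ)‖ with hD
  have hD2 : l ^ 4 * (ξ * t ^ 3) ≤ (2 * Real.pi ^ 2 * D) ^ 2 := by
    have h1 : l ^ 4 * (ξ * t ^ 3) ≤ l ^ 4 * (ξ ^ 4 + t ^ 4) := by gcongr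
    have h2 : Real.pi ^ 4 * (a ^ 2 + d) ≤ Real.pi ^ 4 * (3 * (a ^ 2 + 2 * (1 - a) * d)) := by gcongr
    have h3 : 0 ≤ Real.pi ^ 4 * D ^ 2 := by positivity
    rw [← hsq] at h2
    nlinarith
  have hmain : l ^ 2 * (Real.sqrt ξ * Real.sqrt t * t) ≤ 2 * Real.pi ^ 2 * D := by
    refine (pow_le_pow_iff_left₀ (by positivity) (by positivity) two_ne_zero).1
      (le_trans (le_of_eq ?_) hD2)
    rw [mul_pow, mul_pow, mul_pow, Real.sq_sqrt hξ0.le, Real.sq_sqrt ht0.le]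
    ring
  have hDpos : 0 < D := by
    have : 0 < l ^ 2 * (Real.sqrt ξ * Real.sqrt t * t) := by positivity
    by_contra hneg
    have : 2 * Real.pi ^ 2 * D ≤ 0 := mul_nonpos_of_nonneg_of_nonpos (by positivity) (not_lt.1 hneg)
    linarith
  rw [norm_div, Complex.norm_real, Real.norm_of_nonneg (by positivity), ← hD, div_le_iff₀ hDpos]
  have hsξ : 0 < Real.sqrt ξ := Real.sqrt_pos.2 hξ0
  have hst : 0 < Real.sqrt t := Real.sqrt_pos.2 ht0
  calc l ^ 2 * t =
      l ^ 2 * (Real.sqrt ξ * Real.sqrt t * t) * ((Real.sqrt ξ)⁻¹ * (Real.sqrt t)⁻¹) := by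
        field_simp
    _ ≤ 2 * Real.pi ^ 2 * D * ((Real.sqrt ξ)⁻¹ * (Real.sqrt t)⁻¹) := by gcongr
    _ = _ := by ring

/-! ### Convergence of the double integral -/

/-- The integrand of the rescaled double integral. -/
def scaledIntegrand (ρ l : ℝ) (n r₁ r₂ e₁ e₂ k₁ k₂ : ℕ) (b : Bool) (ξ t : ℝ) : ℂ :=
  (lineFactor ρ n r₁ e₁ k₁ (l * ξ) : ℂ) * circleFactor ρ n r₂ e₂ k₂ b (l ^ 2 * t ^ 2 / 4) *
    ((l ^ 2 * t : ℝ) / (circlePt b (l ^ 2 * t ^ 2 / 4) - (Real.cos (l * ξ / 2) ^ 2 : ℝ)))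

/-- The pointwise limit of `scaledIntegrand`. -/
def limitIntegrand (σ₁ η₁ σ₂ η₂ : ℝ) (b : Bool) (ξ t : ℝ) : ℂ :=
  Complex.exp (-η₁ * ξ ^ 2 - ξ ^ 4) * Complex.cos (σ₁ * ξ) *
    (Complex.exp (η₂ * (t * rayDir b) ^ 2 + (t * rayDir b) ^ 4) *
      Complex.cos (σ₂ * (t * rayDir b))) * (4 * t / ((ξ : ℂ) ^ 2 - (t * rayDir b) ^ 2))

theorem measurable_scaledIntegrand (ρ l : ℝ) (n r₁ r₂ e₁ e₂ k₁ k₂ : ℕ) (b : Bool) :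
    Measurable (fun p : ℝ × ℝ => scaledIntegrand ρ l n r₁ r₂ e₁ e₂ k₁ k₂ b p.1 p.2) := by
  unfold scaledIntegrand lineFactor circleFactor circleJacobi circleRoot circlePt
  fun_prop

theorem measurable_limitIntegrand (σ₁ η₁ σ₂ η₂ : ℝ) (b : Bool) :
    Measurable (fun p : ℝ × ℝ => limitIntegrand σ₁ η₁ σ₂ η₂ b p.1 p.2) := by
  unfold limitIntegrand
  fun_prop

theorem integrableOn_exp_neg_mul_inv_sqrt :
    IntegrableOn (fun x : ℝ => Real.exp (-x) * (Real.sqrt x)⁻¹) (Ioi 0) := by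
  refine (Real.GammaIntegral_convergent (s := 1 / 2) (by norm_num)).congr_fun
    (fun x hx => ?_) measurableSet_Ioi
  have hx0 : (0 : ℝ) < x := hx
  dsimp only
  rw [Real.sqrt_eq_rpow, ← Real.rpow_neg hx0.le]
  norm_num

theorem exists_scaledIntegrand_bound {ρ η₁ η₂ σ₂ : ℝ} {l : ℕ → ℝ} {n r₁ r₂ k₁ k₂ : ℕ → ℕ}
    (e₁ e₂ : ℕ) (b : Bool) (H₁ : IsScaling ρ η₁ l n r₁) (H₂ : IsScaling ρ η₂ l n r₂)
    (hk₂ : Tendsto (fun N => (k₂ N : ℝ) * (l N / 2)) atTop (𝓝 σ₂)) :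
    ∃ C : ℝ, 0 ≤ C ∧ ∀ᶠ N in atTop, ∀ ξ ∈ Ioo 0 (Real.pi / l N),
      ∀ t ∈ Ioo 0 (2 * Real.sqrt Real.pi / l N),
      ‖scaledIntegrand ρ (l N) (n N) (r₁ N) (r₂ N) e₁ e₂ (k₁ N) (k₂ N) b ξ t‖ ≤
        C * ((Real.exp (-ξ) * (Real.sqrt ξ)⁻¹) * (Real.exp (-t) * (Real.sqrt t)⁻¹)) := by
  obtain ⟨C₁, hC₁, h₁⟩ := H₁.lineFactor_le e₁ k₁
  obtain ⟨C₂, hC₂, h₂⟩ := H₂.circleFactor_le e₂ b hk₂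
  refine ⟨C₁ * C₂ * (2 * Real.pi ^ 2), by positivity, ?_⟩
  filter_upwards [H₁.pos, h₁, h₂] with N hl g₁ g₂ ξ hξ t ht
  rw [scaledIntegrand, norm_mul, norm_mul, Complex.norm_real, Real.norm_eq_abs]
  calc _ ≤ (C₁ * Real.exp (-ξ)) * (C₂ * Real.exp (-t)) *
        (2 * Real.pi ^ 2 * ((Real.sqrt ξ)⁻¹ * (Real.sqrt t)⁻¹)) := by
        gcongr
        · exact g₁ ξ hξ
        · exact g₂ t ht
        · exact norm_cauchy_factor_le b hl hξ ht
    _ = _ := by ring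

theorem tendsto_scaledIntegrand {ρ η₁ η₂ σ₁ σ₂ : ℝ} {l : ℕ → ℝ} {n r₁ r₂ k₁ k₂ : ℕ → ℕ}
    (e₁ e₂ : ℕ) (b : Bool) (H₁ : IsScaling ρ η₁ l n r₁) (H₂ : IsScaling ρ η₂ l n r₂)
    (hk₁ : Tendsto (fun N => (k₁ N : ℝ) * (l N / 2)) atTop (𝓝 σ₁))
    (hk₂ : Tendsto (fun N => (k₂ N : ℝ) * (l N / 2)) atTop (𝓝 σ₂)) {ξ t : ℝ} (ht : 0 < t) :
    Tendsto (fun N => scaledIntegrand ρ (l N) (n N) (r₁ N) (r₂ N) e₁ e₂ (k₁ N) (k₂ N) b ξ t)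
      atTop (𝓝 (limitIntegrand σ₁ η₁ σ₂ η₂ b ξ t)) :=
  ((H₁.tendsto_lineFactor e₁ hk₁).mul (H₂.tendsto_circleFactor ht e₂ b hk₂)).mul
    (tendsto_cauchy_factor b ht H₁.pos H₁.tendsto_zero)

theorem tendsto_double_integral {ρ η₁ η₂ σ₁ σ₂ : ℝ} {l : ℕ → ℝ} {n r₁ r₂ k₁ k₂ : ℕ → ℕ}
    (e₁ e₂ : ℕ) (H₁ : IsScaling ρ η₁ l n r₁) (H₂ : IsScaling ρ η₂ l n r₂)
    (hk₁ : Tendsto (fun N => (k₁ N : ℝ) * (l N / 2)) atTop (𝓝 σ₁))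
    (hk₂ : Tendsto (fun N => (k₂ N : ℝ) * (l N / 2)) atTop (𝓝 σ₂)) :
    Tendsto (fun N => ∫ ξ in Ioo 0 (Real.pi / l N), ∑ b : Bool,
      ∫ t in Ioo 0 (2 * Real.sqrt Real.pi / l N),
        scaledIntegrand ρ (l N) (n N) (r₁ N) (r₂ N) e₁ e₂ (k₁ N) (k₂ N) b ξ t) atTop
      (𝓝 (∑ b : Bool, ∫ t in Ioi 0, ∫ ξ in Ioi 0, limitIntegrand σ₁ η₁ σ₂ η₂ b ξ t)) := by
  set S : ℕ → Set (ℝ × ℝ) := fun N =>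
    Ioo 0 (Real.pi / l N) ×ˢ Ioo 0 (2 * Real.sqrt Real.pi / l N) with hS
  have hSm : ∀ N, MeasurableSet (S N) := fun N => measurableSet_Ioo.prod measurableSet_Ioo
  have hS0 : ∀ N, S N ⊆ Ioi 0 ×ˢ Ioi 0 := fun N =>
    prod_mono Ioo_subset_Ioi_self Ioo_subset_Ioi_self
  set T : Set (ℝ × ℝ) := Ioi 0 ×ˢ Ioi 0 with hT
  have hTm : MeasurableSet T := measurableSet_Ioi.prod measurableSet_Ioi
  set F : Bool → ℕ → ℝ × ℝ → ℂ := fun b N p =>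
    scaledIntegrand ρ (l N) (n N) (r₁ N) (r₂ N) e₁ e₂ (k₁ N) (k₂ N) b p.1 p.2 with hF
  set G : Bool → ℝ × ℝ → ℂ := fun b p => limitIntegrand σ₁ η₁ σ₂ η₂ b p.1 p.2 with hG
  have hFm : ∀ b N, Measurable (F b N) := fun b N => measurable_scaledIntegrand _ _ _ _ _ _ _ _ _ b
  set g : ℝ → ℝ := fun x => Real.exp (-x) * (Real.sqrt x)⁻¹ with hg
  have hgint : Integrable (fun p : ℝ × ℝ => g p.1 * g p.2)
      ((volume.restrict (Ioi 0)).prod (volume.restrict (Ioi 0))) :=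
    Integrable.mul_prod integrableOn_exp_neg_mul_inv_sqrt integrableOn_exp_neg_mul_inv_sqrt
  set μ : Measure (ℝ × ℝ) := (volume.restrict (Ioi 0)).prod (volume.restrict (Ioi 0)) with hμ
  have hμ' : μ = (volume.prod volume).restrict T := Measure.prod_restrict _ _
  have hμS : ∀ N, μ.restrict (S N) = (volume.restrict (Ioo 0 (Real.pi / l N))).prod
      (volume.restrict (Ioo 0 (2 * Real.sqrt Real.pi / l N))) := by
    intro N
    rw [hμ', Measure.restrict_restrict (hSm N), inter_eq_left.2 (hS0 N), Measure.prod_restrict]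
  have haeT : ∀ᵐ p ∂μ, p ∈ T := by
    rw [hμ']; exact ae_restrict_mem hTm
  have hbound : ∀ b, ∃ C : ℝ, 0 ≤ C ∧ ∀ᶠ N in atTop, ∀ p,
      ‖(S N).indicator (F b N) p‖ ≤ C * (g p.1 * g p.2) := by
    intro b
    obtain ⟨C, hC, h⟩ := exists_scaledIntegrand_bound (k₁ := k₁) e₁ e₂ b H₁ H₂ hk₂
    refine ⟨C, hC, h.mono fun N hN p => ?_⟩
    by_cases hp : p ∈ S N
    · rw [indicator_of_mem hp]
      exact hN p.1 hp.1 p.2 hp.2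
    · rw [indicator_of_notMem hp, norm_zero]
      positivity
  have hlim : ∀ b, ∀ p ∈ T, Tendsto (fun N => (S N).indicator (F b N) p) atTop (𝓝 (G b p)) := by
    intro b p hp
    refine (tendsto_scaledIntegrand e₁ e₂ b H₁ H₂ hk₁ hk₂ (ξ := p.1) hp.2).congr' ?_
    have h1 : Tendsto (fun N => p.1 * l N) atTop (𝓝 0) := by
      simpa using H₁.tendsto_zero.const_mul p.1
    have h2 : Tendsto (fun N => p.2 * l N) atTop (𝓝 0) := by
      simpa using H₁.tendsto_zero.const_mul p.2
    filter_upwards [H₁.pos, h1.eventually_lt_const Real.pi_pos,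
      h2.eventually_lt_const (by positivity : 0 < 2 * Real.sqrt Real.pi)] with N hl q1 q2
    rw [indicator_of_mem]
    exact ⟨⟨hp.1, (lt_div_iff₀ hl).2 q1⟩, ⟨hp.2, (lt_div_iff₀ hl).2 q2⟩⟩
  -- The limit inherits the dominating function. Its integrability permits Fubini, needed because
  -- the kernel has `x` as the outer variable and the Pearcey integral has `u`.
  have hGint : ∀ b, Integrable (G b) μ := by
    intro b
    obtain ⟨C, hC, h⟩ := hbound b
    refine (hgint.const_mul C).mono' (measurable_limitIntegrand _ _ _ _ b).aestronglyMeasurable ?_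
    filter_upwards [haeT] with p hp
    exact le_of_tendsto (hlim b p hp).norm (h.mono fun N hN => hN p)
  have hFint : ∀ᶠ N in atTop, ∀ b, IntegrableOn (F b N) (S N) μ := by
    rw [eventually_all]
    intro b
    obtain ⟨C, hC, h⟩ := hbound b
    refine h.mono fun N hN => ?_
    rw [← integrable_indicator_iff (hSm N)]
    exact (hgint.const_mul C).mono' ((hFm b N).indicator (hSm N)).aestronglyMeasurable
      (Eventually.of_forall hN)
  have hconv : ∀ b, Tendsto (fun N => ∫ p, (S N).indicator (F b N) p ∂μ) atTop
      (𝓝 (∫ p, G b p ∂μ)) := by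
    intro b
    obtain ⟨C, hC, h⟩ := hbound b
    refine tendsto_integral_filter_of_dominated_convergence (fun p => C * (g p.1 * g p.2))
      (Eventually.of_forall fun N => ((hFm b N).indicator (hSm N)).aestronglyMeasurable)
      (h.mono fun N hN => Eventually.of_forall hN) (hgint.const_mul C) ?_
    filter_upwards [haeT] with p hp using hlim b p hp
  have hsum := tendsto_finsetSum Finset.univ fun b _ => hconv b
  have hGsymm : ∀ b, ∫ p, G b p ∂μ =
      ∫ t in Ioi 0, ∫ ξ in Ioi 0, limitIntegrand σ₁ η₁ σ₂ η₂ b ξ t :=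
    fun b => integral_prod_symm _ (hGint b)
  simp_rw [hGsymm] at hsum
  refine hsum.congr' (hFint.mono fun N hN => ?_)
  have hN' : ∀ b, Integrable (F b N) ((volume.restrict (Ioo 0 (Real.pi / l N))).prod
      (volume.restrict (Ioo 0 (2 * Real.sqrt Real.pi / l N)))) := by
    intro b
    rw [← hμS]
    exact hN b
  refine Eq.trans ?_ (integral_finsetSum _ fun b _ => (hN' b).integral_prod_left).symm
  refine Finset.sum_congr rfl fun b _ => ?_
  rw [integral_indicator (hSm N), hμS, integral_prod _ (hN' b)]

theorem limitIntegrand_eq (σ₁ η₁ σ₂ η₂ : ℝ) (b : Bool) (ξ : ℝ) {t : ℝ} (ht : 0 < t) :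
    limitIntegrand σ₁ η₁ σ₂ η₂ b ξ t =
      pearceyIntegrand σ₁ η₁ σ₂ η₂ ξ (t * rayDir b) * (-4 * (rayDir b)⁻¹) := by
  have hne := rayDir_sq_mul_ne b (ξ := ξ) ht
  have hne' : ((t : ℂ) * rayDir b) ^ 2 - (ξ : ℂ) ^ 2 ≠ 0 := by
    rw [← neg_sub]; exact neg_ne_zero.2 hne
  have hω : rayDir b ≠ 0 := by
    intro h
    have := norm_rayDir b
    rw [h, norm_zero] at this
    exact zero_ne_one this
  rw [limitIntegrand, pearceyIntegrand]
  have e : Complex.exp (-(η₁ : ℂ) * (ξ : ℂ) ^ 2 + (η₂ : ℂ) * (t * rayDir b) ^ 2 +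
      (t * rayDir b) ^ 4 - (ξ : ℂ) ^ 4) = Complex.exp (-η₁ * ξ ^ 2 - ξ ^ 4) *
      Complex.exp (η₂ * (t * rayDir b) ^ 2 + (t * rayDir b) ^ 4) := by
    rw [← Complex.exp_add]; congr 1; ring
  have e2 : 4 * (t : ℂ) / ((ξ : ℂ) ^ 2 - (t * rayDir b) ^ 2) =
      t * rayDir b / ((t * rayDir b) ^ 2 - (ξ : ℂ) ^ 2) * (-4 * (rayDir b)⁻¹) := by
    rw [div_mul_eq_mul_div, div_eq_div_iff hne hne']
    field_simp
    ring
  rw [e, e2]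
  ring

theorem sum_limitIntegrand_eq (σ₁ η₁ σ₂ η₂ : ℝ) :
    ∑ b : Bool, ∫ t in Ioi 0, ∫ ξ in Ioi 0, limitIntegrand σ₁ η₁ σ₂ η₂ b ξ t =
      -4 * Complex.I *
        rayIntegral (fun u => ∫ x in Ioi (0 : ℝ), pearceyIntegrand σ₁ η₁ σ₂ η₂ x u) := by
  -- The inverses carry opposite factors `∓i`, which supply the opposite orientations of the two
  -- rays.
  have hinv : ∀ b, (rayDir b)⁻¹ = rayDir b * (if b then -Complex.I else Complex.I) := by
    intro b
    refine inv_eq_of_mul_eq_one_right ?_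
    rw [← mul_assoc, ← sq, rayDir_sq]
    cases b <;> simp
  have h : ∀ b, ∫ t in Ioi 0, ∫ ξ in Ioi 0, limitIntegrand σ₁ η₁ σ₂ η₂ b ξ t =
      (-4 * (if b then -Complex.I else Complex.I)) * ∫ t in Ioi (0 : ℝ),
        (∫ x in Ioi (0 : ℝ), pearceyIntegrand σ₁ η₁ σ₂ η₂ x (t * rayDir b)) * rayDir b := by
    intro b
    rw [← integral_const_mul]
    refine setIntegral_congr_fun measurableSet_Ioi fun t ht => ?_
    simp_rw [limitIntegrand_eq σ₁ η₁ σ₂ η₂ b _ ht]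
    rw [integral_mul_const, hinv]
    ring
  rw [Fintype.sum_bool, h, h, rayIntegral]
  simp only [rayDir, if_true, Bool.false_eq_true, if_false]
  ring

/-! ### Asymptotics of cosine integrals -/

/-- The integral of `cos (q z) (cos z)^m` over `[0, π/2]`. -/
def cosIntegral (m : ℕ) (q : ℝ) : ℝ :=
  ∫ z in (0 : ℝ)..(Real.pi / 2), Real.cos (q * z) * Real.cos z ^ m

theorem cosIntegral_zero_of_int {j : ℤ} (hj : j ≠ 0) : cosIntegral 0 (2 * j) = 0 := by
  have hj' : (2 * j : ℝ) ≠ 0 := by exact_mod_cast mul_ne_zero two_ne_zero hj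
  simp only [cosIntegral, pow_zero, mul_one]
  rw [intervalIntegral.integral_comp_mul_left (fun x => Real.cos x) hj', integral_cos,
    show 2 * (j : ℝ) * (Real.pi / 2) = j * Real.pi by ring, Real.sin_int_mul_pi]
  simp

theorem cosIntegral_zero_zero : cosIntegral 0 0 = Real.pi / 2 := by
  simp [cosIntegral]

theorem cos_pow_le_exp (m : ℕ) {z : ℝ} (h0 : 0 ≤ z) (h1 : z ≤ Real.pi / 2) :
    Real.cos z ^ m ≤ Real.exp (-(2 * m / Real.pi ^ 2) * z ^ 2) := by
  have hc := Real.cos_le_one_sub_mul_cos_sq (x := z) (abs_le.2 ⟨by linarith, by linarith⟩)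
  have hc0 : 0 ≤ Real.cos z := Real.cos_nonneg_of_mem_Icc ⟨by linarith, h1⟩
  have h : Real.cos z ≤ Real.exp (-(2 / Real.pi ^ 2 * z ^ 2)) := by
    linarith [Real.add_one_le_exp (-(2 / Real.pi ^ 2 * z ^ 2))]
  refine (pow_le_pow_left₀ hc0 h m).trans_eq ?_
  rw [← Real.exp_nat_mul]
  congr 1
  ring

theorem integral_cos_pow_le {m : ℕ} (hm : 0 < m) :
    ∫ z in (0 : ℝ)..(Real.pi / 2), Real.cos z ^ m ≤
      Real.sqrt (Real.pi / (2 * m / Real.pi ^ 2)) / 2 := by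
  have hm' : (0 : ℝ) < 2 * m / Real.pi ^ 2 := by positivity
  have hi := integrable_exp_neg_mul_sq hm'
  rw [← integral_gaussian_Ioi, intervalIntegral.integral_of_le (by positivity)]
  calc ∫ z in Ioc 0 (Real.pi / 2), Real.cos z ^ m
      ≤ ∫ z in Ioc 0 (Real.pi / 2), Real.exp (-(2 * m / Real.pi ^ 2) * z ^ 2) := by
        refine setIntegral_mono_on ?_ hi.integrableOn measurableSet_Ioc fun z hz =>
          cos_pow_le_exp m hz.1.le hz.2
        exact (Continuous.integrableOn_Icc (by fun_prop)).mono_set Ioc_subset_Icc_self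
    _ ≤ _ := setIntegral_mono_set hi.integrableOn
        (Eventually.of_forall fun z => (Real.exp_pos _).le)
        (Eventually.of_forall fun z hz => hz.1)

/-- Two integrations by parts gain `m/q²` and leave the integral of `cos(qz) R(z)` with `R = (cos^j
· sin)'`, `j = m - 1`. Pointwise `|R| ≤ 2cos^m - R`, and the integral of `R` is a boundary value, so
everything is controlled by the integral of `cos^m`, which is of order `m^(-1/2)`. -/
theorem abs_cosIntegral_le {m : ℕ} (hm : 0 < m) {q : ℝ} (hq : q ≠ 0) :
    |cosIntegral m q| ≤ m / q ^ 2 * Real.sqrt (Real.pi / (2 * m / Real.pi ^ 2)) := by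
  obtain ⟨j, rfl⟩ : ∃ j, m = j + 1 := ⟨m - 1, by omega⟩
  set R : ℝ → ℝ := fun z => Real.cos z ^ (j + 1) - j * Real.cos z ^ (j - 1) * Real.sin z ^ 2 with hR
  have hpi : 0 ≤ Real.pi / 2 := by positivity
  have dB : ∀ z, HasDerivAt (fun z => Real.cos z ^ j * Real.sin z) (R z) z := by
    intro z
    refine (((Real.hasDerivAt_cos z).pow j).mul (Real.hasDerivAt_sin z)).congr_deriv ?_
    simp only [hR, Pi.pow_apply]
    ring
  have dA : ∀ z, HasDerivAt (fun z => Real.sin (q * z) / q * Real.cos z ^ (j + 1) -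
      (j + 1) / q ^ 2 * (Real.cos (q * z) * (Real.cos z ^ j * Real.sin z)))
      (Real.cos (q * z) * Real.cos z ^ (j + 1) - (j + 1) / q ^ 2 * (Real.cos (q * z) * R z)) z := by
    intro z
    have h1 : HasDerivAt (fun z => Real.sin (q * z)) (Real.cos (q * z) * q) z := by
      simpa using ((hasDerivAt_id z).const_mul q).sin
    have h2 : HasDerivAt (fun z => Real.cos (q * z)) (-Real.sin (q * z) * q) z := by
      simpa using ((hasDerivAt_id z).const_mul q).cos
    have h3 : HasDerivAt (fun z => Real.cos z ^ (j + 1)) ((j +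
        1) * Real.cos z ^ j * -Real.sin z) z := by
      simpa using (Real.hasDerivAt_cos z).fun_pow (j + 1)
    refine (((h1.div_const q).mul h3).sub ((h2.mul (dB z)).const_mul _)).congr_deriv ?_
    field_simp
    ring
  have hRc : Continuous R := by simp only [hR]; fun_prop
  have iB := intervalIntegral.integral_eq_sub_of_hasDerivAt (fun z _ => dB z)
    (hRc.intervalIntegrable 0 (Real.pi / 2))
  have iA := intervalIntegral.integral_eq_sub_of_hasDerivAt (fun z _ => dA z)
    ((by fun_prop : Continuous fun z => Real.cos (q * z) * Real.cos z ^ (j + 1) -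
      (j + 1) / q ^ 2 * (Real.cos (q * z) * R z)).intervalIntegrable 0 (Real.pi / 2))
  have c1 : Continuous fun z => Real.cos (q * z) * Real.cos z ^ (j + 1) := by fun_prop
  have c2 : Continuous fun z => (j + 1) / q ^ 2 * (Real.cos (q * z) * R z) := by fun_prop
  have c3 : Continuous fun z => Real.cos (q * z) * R z := by fun_prop
  have c4 : Continuous fun z => 2 * Real.cos z ^ (j + 1) - R z := by fun_prop
  have c5 : Continuous fun z => 2 * Real.cos z ^ (j + 1) := by fun_prop
  rw [intervalIntegral.integral_sub (c1.intervalIntegrable _ _) (c2.intervalIntegrable _ _),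
    intervalIntegral.integral_const_mul] at iA
  simp only [Real.cos_pi_div_two, Real.sin_pi_div_two, Real.cos_zero, Real.sin_zero, mul_zero,
    mul_one, sub_zero, zero_div, zero_mul, zero_pow (Nat.succ_ne_zero j), zero_sub] at iA iB
  -- The boundary value of `cos^j · sin` at `π/2`, nonzero only for `j = 0`. The `-δ` gained in
  -- `hbd` offsets this boundary term in `hfin`.
  set δ : ℝ := (0 : ℝ) ^ j with hδ
  have hδ0 : 0 ≤ δ := by positivity
  have hbd : |∫ z in (0 : ℝ)..(Real.pi / 2), Real.cos (q * z) * R z| ≤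
      2 * (∫ z in (0 : ℝ)..(Real.pi / 2), Real.cos z ^ (j + 1)) - δ := by
    rw [← iB, ← intervalIntegral.integral_const_mul, ← intervalIntegral.integral_sub
      (c5.intervalIntegrable _ _) (hRc.intervalIntegrable _ _)]
    refine (intervalIntegral.abs_integral_le_integral_abs hpi).trans ?_
    refine intervalIntegral.integral_mono_on hpi (c3.abs.intervalIntegrable _ _)
      (c4.intervalIntegrable _ _) fun z hz => ?_
    have hc0 : 0 ≤ Real.cos z := Real.cos_nonneg_of_mem_Icc ⟨by linarith [hz.1], hz.2⟩
    have e1 : 0 ≤ Real.cos z ^ (j + 1) := by positivity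
    have e2 : 0 ≤ j * Real.cos z ^ (j - 1) * Real.sin z ^ 2 := by positivity
    rw [abs_mul]
    refine (mul_le_of_le_one_left (abs_nonneg _) (Real.abs_cos_le_one _)).trans ?_
    rw [abs_le]
    simp only [hR]
    constructor <;> linarith
  have hm := integral_cos_pow_le hm
  have hk : (0 : ℝ) ≤ (j + 1) / q ^ 2 := by positivity
  have hval : cosIntegral (j + 1) q = (j + 1) / q ^ 2 *
      ((∫ z in (0 : ℝ)..(Real.pi / 2), Real.cos (q * z) * R z) -
        Real.cos (q * (Real.pi / 2)) * δ) := by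
    rw [cosIntegral]
    linarith
  have hfin : |(∫ z in (0 : ℝ)..(Real.pi / 2), Real.cos (q * z) * R z) -
      Real.cos (q * (Real.pi / 2)) * δ| ≤
          2 * (∫ z in (0 : ℝ)..(Real.pi / 2), Real.cos z ^ (j + 1)) := by
    refine (abs_sub _ _).trans ?_
    rw [abs_mul, abs_of_nonneg hδ0]
    have := mul_le_of_le_one_left hδ0 (Real.abs_cos_le_one (q * (Real.pi / 2)))
    linarith
  rw [hval, abs_mul, abs_of_nonneg hk]
  push_cast at hm ⊢
  gcongr
  linarith

theorem integral_cos_mul_gaussian {d : ℝ} (hd : 0 < d) (a : ℝ) :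
    ∫ x in Ioi (0 : ℝ), Real.cos (a * x) * Real.exp (-d * x ^ 2) =
      Real.sqrt (Real.pi / d) / 2 * Real.exp (-a ^ 2 / (4 * d)) := by
  have h := fourierIntegral_gaussian (b := (d : ℂ)) (by simpa using hd) (a : ℂ)
  have hint : Integrable fun x : ℝ => Complex.exp (Complex.I * a * x) * Complex.exp (-d *
      (x : ℂ) ^ 2) := by
    refine (integrable_exp_neg_mul_sq hd).mono' (by fun_prop) (Eventually.of_forall fun x => ?_)
    rw [norm_mul, Complex.norm_exp, Complex.norm_exp]
    simp [← Complex.ofReal_pow]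
  have h2 := congrArg Complex.re h
  rw [← RCLike.re_eq_complex_re, ← integral_re hint] at h2
  have e1 : ∀ x : ℝ, RCLike.re (Complex.exp (Complex.I * a * x) * Complex.exp (-d * (x : ℂ) ^ 2)) =
      (fun y => Real.cos (a * y) * Real.exp (-d * y ^ 2)) |x| := by
    intro x
    have : -(d : ℂ) * (x : ℂ) ^ 2 = ((-d * x ^ 2 : ℝ) : ℂ) := by push_cast; ring
    rw [this, ← Complex.ofReal_exp, RCLike.re_eq_complex_re, Complex.re_mul_ofReal,
      show Complex.I * a * x = ((a * x : ℝ) : ℂ) * Complex.I by push_cast; ring,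
      Complex.exp_ofReal_mul_I_re]
    dsimp only
    rw [sq_abs]
    congr 1
    rcases abs_cases x with ⟨h, _⟩ | ⟨h, _⟩ <;> rw [h]
    rw [mul_neg, Real.cos_neg]
  simp_rw [e1] at h2
  rw [integral_comp_abs (f := fun y => Real.cos (a * y) * Real.exp (-d * y ^ 2))] at h2
  have e2 : RCLike.re (((Real.pi : ℂ) / d) ^ (1 / 2 : ℂ) * Complex.exp (-(a : ℂ) ^ 2 / (4 * d))) =
      Real.sqrt (Real.pi / d) * Real.exp (-a ^ 2 / (4 * d)) := by
    rw [show (Real.pi : ℂ) / d = ((Real.pi / d : ℝ) : ℂ) by push_cast; rfl,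
      show (1 / 2 : ℂ) = ((1 / 2 : ℝ) : ℂ) by push_cast; rfl,
      ← Complex.ofReal_cpow (by positivity), ← Real.sqrt_eq_rpow,
      show -(a : ℂ) ^ 2 / (4 * d) = ((-a ^ 2 / (4 * d) : ℝ) : ℂ) by push_cast; rfl,
      ← Complex.ofReal_exp, ← Complex.ofReal_mul]
    exact Complex.ofReal_re _
  rw [e2] at h2
  linarith

/-- After `z = μx`, `cos^m(μx)` behaves like `exp(-mμ²x²/2)`, so `2d` is the natural limit of `mμ²`;
`cos_pow_le_exp` provides a Gaussian majorant. -/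
theorem tendsto_cosIntegral_gaussian {μ : ℕ → ℝ} (hpos : ∀ᶠ N in atTop, 0 < μ N)
    (hμ : Tendsto μ atTop (𝓝 0)) {m : ℕ → ℕ} {q : ℕ → ℝ} {d a : ℝ} (hd : 0 < d)
    (hm : Tendsto (fun N => (m N : ℝ) * μ N ^ 2) atTop (𝓝 (2 * d)))
    (hq : Tendsto (fun N => q N * μ N) atTop (𝓝 a)) :
    Tendsto (fun N => cosIntegral (m N) (q N) / μ N) atTop
      (𝓝 (Real.sqrt (Real.pi / d) / 2 * Real.exp (-a ^ 2 / (4 * d)))) := by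
  rw [← integral_cos_mul_gaussian hd a]
  set F : ℕ → ℝ → ℝ := fun N x => Real.cos (q N * μ N * x) * Real.cos (μ N * x) ^ m N with hF
  have hscale : ∀ᶠ N in atTop, ∫ x in Ioi (0 : ℝ), (Ioc 0 (Real.pi / 2 / μ N)).indicator (F N) x =
      cosIntegral (m N) (q N) / μ N := by
    filter_upwards [hpos] with N hN
    rw [setIntegral_indicator measurableSet_Ioc, inter_eq_right.2 Ioc_subset_Ioi_self,
      ← intervalIntegral.integral_of_le (by positivity), cosIntegral]
    have := intervalIntegral.integral_comp_mul_left (a := 0) (b := Real.pi / 2 / μ N)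
      (fun z => Real.cos (q N * z) * Real.cos z ^ m N) hN.ne'
    rw [mul_zero, mul_div_cancel₀ _ hN.ne', smul_eq_mul, ← div_eq_inv_mul] at this
    rw [← this]
    simp only [hF, mul_assoc]
  refine Tendsto.congr' hscale ?_
  have hpow : ∀ x : ℝ, Tendsto (fun N => Real.cos (μ N * x) ^ m N) atTop
      (𝓝 (Real.exp (-d * x ^ 2))) := by
    intro x
    have h1 := (tendsto_sin_sq_div hpos hμ x).const_mul (-2)
    have hmC := (Complex.continuous_ofReal.tendsto _).comp hm
    have hlC : Tendsto (fun N => (μ N : ℂ)) atTop (𝓝 0) := by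
      simpa [Function.comp_def] using (Complex.continuous_ofReal.tendsto 0).comp hμ
    have hg : Tendsto (fun N => ((Real.cos (μ N * x) - 1 : ℝ) : ℂ)) atTop (𝓝 0) := by
      have hc : Continuous fun y : ℝ => ((Real.cos (y * x) - 1 : ℝ) : ℂ) := by fun_prop
      have := (hc.tendsto 0).comp hμ
      simpa [Function.comp_def] using this
    have hk : Tendsto (fun N => (m N : ℂ) * ((Real.cos (μ N * x) - 1 : ℝ) : ℂ)) atTop
        (𝓝 (((-d * x ^ 2 : ℝ) : ℂ))) := by
      have h2 := hmC.mul h1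
      have e : ((2 * d : ℝ) : ℂ) * (-2 * ((x : ℂ) ^ 2 / 4)) = ((-d * x ^ 2 : ℝ) : ℂ) := by
        push_cast; ring
      rw [e] at h2
      refine h2.congr' (hpos.mono fun N hN => ?_)
      have h0 : (μ N : ℂ) ≠ 0 := by exact_mod_cast hN.ne'
      have hs : Real.cos (μ N * x) - 1 = -2 * Real.sin (μ N * x / 2) ^ 2 := by
        have h3 := Real.cos_two_mul (μ N * x / 2)
        rw [mul_div_cancel₀ _ two_ne_zero, Real.cos_sq'] at h3
        linarith
      beta_reduce
      rw [hs]
      simp only [Function.comp]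
      push_cast
      field_simp
    have := (Complex.continuous_re.tendsto _).comp (tendsto_one_add_pow_exp hg hk)
    rw [← Complex.ofReal_exp, Complex.ofReal_re] at this
    refine this.congr fun N => ?_
    simp only [Function.comp]
    rw [show (1 : ℂ) + ((Real.cos (μ N * x) - 1 : ℝ) : ℂ) = ((Real.cos (μ N * x) : ℝ) : ℂ) by
      push_cast; ring, ← Complex.ofReal_pow, Complex.ofReal_re]
  refine tendsto_integral_filter_of_dominated_convergence
    (fun x => Real.exp (-(2 * d / Real.pi ^ 2) * x ^ 2)) ?_ ?_
    (integrable_exp_neg_mul_sq (by positivity)).integrableOn ?_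
  · refine Eventually.of_forall fun N => Measurable.aestronglyMeasurable ?_
    exact Measurable.indicator (by simp only [hF]; fun_prop) measurableSet_Ioc
  · filter_upwards [hpos, hm.eventually_const_le (by linarith : d < 2 * d)] with N hN hmN
    refine Eventually.of_forall fun x => ?_
    by_cases hx : x ∈ Ioc 0 (Real.pi / 2 / μ N)
    · rw [indicator_of_mem hx]
      have hx0 := hx.1
      have hx1 : μ N * x ≤ Real.pi / 2 := by
        have := (le_div_iff₀ hN).1 hx.2
        linarith
      have hx2 : 0 ≤ μ N * x := by positivity
      have hc0 : 0 ≤ Real.cos (μ N * x) := Real.cos_nonneg_of_mem_Icc ⟨by linarith, hx1⟩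
      simp only [hF]
      rw [Real.norm_eq_abs, abs_mul, abs_of_nonneg (pow_nonneg hc0 _)]
      refine (mul_le_of_le_one_left (pow_nonneg hc0 _) (Real.abs_cos_le_one _)).trans ?_
      refine (cos_pow_le_exp (m N) hx2 hx1).trans (Real.exp_le_exp.2 ?_)
      have : 2 * d / Real.pi ^ 2 * x ^ 2 ≤ 2 * m N / Real.pi ^ 2 * (μ N * x) ^ 2 := by
        calc 2 * d / Real.pi ^ 2 * x ^ 2 = d * (2 / Real.pi ^ 2 * x ^ 2) := by ring
          _ ≤ (m N * μ N ^ 2) * (2 / Real.pi ^ 2 * x ^ 2) := by gcongr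
          _ = _ := by ring
      linarith
    · rw [indicator_of_notMem hx, norm_zero]
      positivity
  · filter_upwards [ae_restrict_mem measurableSet_Ioi] with x hx
    have hx0 : (0 : ℝ) < x := hx
    have hcos : Tendsto (fun N => Real.cos (q N * μ N * x)) atTop (𝓝 (Real.cos (a * x))) :=
      (Real.continuous_cos.tendsto _).comp (hq.mul_const x)
    refine (hcos.mul (hpow x)).congr' ?_
    have h1 : Tendsto (fun N => x * μ N) atTop (𝓝 0) := by simpa using hμ.const_mul x
    filter_upwards [hpos, h1.eventually_le_const (by positivity : 0 < Real.pi / 2)] with N hN h1N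
    have hmem : x ∈ Ioc 0 (Real.pi / 2 / μ N) := ⟨hx0, (le_div_iff₀ hN).2 h1N⟩
    rw [indicator_of_mem hmem]

/-- `abs_cosIntegral_le` divided by `μ` is a constant times `√(mμ²)/(qμ)²`. The case `m = 0` is
excluded: there boundary terms can keep the integral of order `1/q`, hence comparable to `μ`. -/
theorem tendsto_cosIntegral_bound {μ : ℕ → ℝ} {m : ℕ → ℕ} {q : ℕ → ℝ} {a : ℝ} (ha : a ≠ 0)
    (hm : Tendsto (fun N => (m N : ℝ) * μ N ^ 2) atTop (𝓝 0))
    (hq : Tendsto (fun N => q N * μ N) atTop (𝓝 a)) (hpos : ∀ᶠ N in atTop, 0 < μ N) :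
    ∃ B : ℕ → ℝ, Tendsto B atTop (𝓝 0) ∧
      ∀ᶠ N in atTop, 0 < m N → |cosIntegral (m N) (q N) / μ N| ≤ B N := by
  refine ⟨fun N => Real.sqrt (Real.pi ^ 3 / 2 * (m N * μ N ^ 2)) / (q N * μ N) ^ 2, ?_, ?_⟩
  · have h1 := (Real.continuous_sqrt.tendsto _).comp (hm.const_mul (Real.pi ^ 3 / 2))
    have := h1.div (hq.pow 2) (pow_ne_zero 2 ha)
    simpa [Function.comp_def, Pi.div_def] using this
  · filter_upwards [hpos, hq.eventually_ne ha] with N hN hqN hmN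
    have hq0 : q N ≠ 0 := left_ne_zero_of_mul hqN
    have hm0 : (0 : ℝ) < m N := by exact_mod_cast hmN
    rw [abs_div, abs_of_pos hN, div_le_iff₀ hN]
    refine (abs_cosIntegral_le hmN hq0).trans (le_of_eq ?_)
    have e1 : Real.pi / (2 * m N / Real.pi ^ 2) = Real.pi ^ 3 / 2 * (1 / m N) := by
      field_simp
    have e2 : Real.sqrt (Real.pi ^ 3 / 2 * (m N * μ N ^ 2)) =
        m N * μ N * Real.sqrt (Real.pi ^ 3 / 2 * (1 / m N)) := by
      rw [show Real.pi ^ 3 / 2 * (m N * μ N ^ 2) =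
        (m N * μ N) ^ 2 * (Real.pi ^ 3 / 2 * (1 / m N)) by field_simp,
        Real.sqrt_mul (by positivity), Real.sqrt_sq (by positivity)]
    rw [e1, e2]
    field_simp

/-! ### The single integral and the indicator -/

/-- The single integral of the kernel. -/
theorem single_integral_eq (r₁ r₂ s₁ s₂ m : ℕ) (a₁ a₂ : HalfSign)
    (hm : 2 * r₁ + a₁.shift = 2 * r₂ + a₂.shift + m) :
    ∫ x in (-1 : ℝ)..1, (jacobi a₁ s₁).eval (x : ℂ) * (jacobi a₂ s₂).eval (x : ℂ) *
        ((x : ℂ) - 1) ^ ((r₁ : ℤ) - (r₂ : ℤ)) * weight a₁ x =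
      (-2 : ℂ) ^ ((r₁ : ℤ) - (r₂ : ℤ)) * (-1 : ℂ) ^ (s₁ + s₂) * 2 ^ a₁.shift *
        ((cosIntegral m ((2 * s₁ + a₁.shift : ℕ) + (2 * s₂ + a₂.shift : ℕ)) +
          cosIntegral m ((2 * s₁ + a₁.shift : ℕ) - (2 * s₂ + a₂.shift : ℕ)) : ℝ) : ℂ) := by
  set k₁ := 2 * s₁ + a₁.shift with hk₁
  set k₂ := 2 * s₂ + a₂.shift with hk₂
  -- The factor `2` from `y = 2z` absorbs the `1/2` of the product-to-sum formula.
  have hY : cosIntegral m ((k₁ : ℝ) + k₂) + cosIntegral m ((k₁ : ℝ) - k₂) =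
      ∫ y in Ioo 0 Real.pi, Real.cos (k₁ * (y / 2)) * Real.cos (k₂ * (y / 2)) *
          Real.cos (y / 2) ^ m := by
    rw [← integral_Ioc_eq_integral_Ioo, ← intervalIntegral.integral_of_le Real.pi_pos.le,
      intervalIntegral.integral_comp_div
        (fun z => Real.cos (k₁ * z) * Real.cos (k₂ * z) * Real.cos z ^ m) two_ne_zero, zero_div,
      cosIntegral, cosIntegral, ← intervalIntegral.integral_add
        (Continuous.intervalIntegrable (by fun_prop) _ _)
        (Continuous.intervalIntegrable (by fun_prop) _ _), smul_eq_mul,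
      ← intervalIntegral.integral_const_mul]
    congr 1
    ext z
    rw [add_mul, sub_mul, Real.cos_add, Real.cos_sub]
    ring
  rw [hY, integral_mul_weight a₁ 1 one_pos, Complex.ofReal_one, one_mul, div_one,
    ← integral_complex_ofReal, ← integral_const_mul]
  refine setIntegral_congr_fun measurableSet_Ioo fun y hy => ?_
  have hc : 0 < Real.cos (y / 2) :=
    Real.cos_pos_of_mem_Ioo ⟨by linarith [hy.1, Real.pi_pos], by linarith [hy.2]⟩
  have hx : (((-Real.cos y : ℝ) : ℂ) - 1) = -2 * (Real.cos (y / 2) : ℂ) ^ 2 := by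
    norm_cast
    rw [Real.cos_sq]
    push_cast
    ring_nf
  have hcC : (Real.cos (y / 2) : ℂ) ≠ 0 := by exact_mod_cast hc.ne'
  simp only [one_mul]
  rw [jacobi_eval_neg_cos a₁ s₁ y hc.ne', jacobi_eval_neg_cos a₂ s₂ y hc.ne', hx, mul_zpow,
    ← hk₁, ← hk₂]
  rw [Complex.ofReal_mul, Complex.ofReal_mul, Complex.ofReal_pow, Complex.ofReal_mul,
    Complex.ofReal_pow, mul_pow]
  generalize (Real.cos (k₁ * (y / 2)) : ℂ) = K1
  generalize (Real.cos (k₂ * (y / 2)) : ℂ) = K2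
  generalize (Real.cos (y / 2) : ℂ) = c at hcC ⊢
  have key : (c ^ 2) ^ ((r₁ : ℤ) - r₂) * (c ^ 2) ^ a₁.shift =
      c ^ m * c ^ a₁.shift * c ^ a₂.shift := by
    rw [zpow_sub₀ (pow_ne_zero 2 hcC), zpow_natCast, zpow_natCast, div_mul_eq_mul_div,
      div_eq_iff (by positivity), ← pow_mul, ← pow_mul, ← pow_mul, ← pow_add, ← pow_add, ← pow_add,
      ← pow_add]
    congr 1
    omega
  have hq1 : c ^ a₁.shift ≠ 0 := pow_ne_zero _ hcC
  have hq2 : c ^ a₂.shift ≠ 0 := pow_ne_zero _ hcC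
  have key2 : (c ^ 2) ^ ((r₁ : ℤ) - r₂) * (c ^ 2) ^ a₁.shift / (c ^ a₁.shift *
      c ^ a₂.shift) = c ^ m := by
    rw [key]; field_simp
  rw [← key2, pow_add]
  push_cast
  field_simp

/-- The normalisation `W` removes the dependence on `a`. At `s = 0` this fails for `a = -1/2`, which
is why `s₁` must be eventually positive. -/
theorem W_mul_two_pow (a : HalfSign) {s : ℕ} (hs : 0 < s) : W a s * 2 ^ a.shift = 2 := by
  cases a <;> simp [W, HalfSign.shift, hs]

theorem level_le_iff (r₁ r₂ : ℕ) (a₁ a₂ : HalfSign) :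
    2 * (r₁ : ℝ) + a₁.val ≥ 2 * (r₂ : ℝ) + a₂.val ↔
      2 * r₂ + a₂.shift ≤ 2 * r₁ + a₁.shift := by
  rw [HalfSign.val_eq, HalfSign.val_eq, ge_iff_le, ← Nat.cast_le (α := ℝ)]
  push_cast
  constructor <;> intro h <;> linarith

theorem neg_one_zpow_mul_pow (s₁ s₂ : ℕ) :
    (-1 : ℂ) ^ ((s₁ : ℤ) - (s₂ : ℤ)) * (-1) ^ (s₁ + s₂) = 1 := by
  rw [zpow_sub₀ (by norm_num), zpow_natCast, zpow_natCast, pow_add]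
  rcases neg_one_pow_eq_or ℂ s₁ with h | h <;> rcases neg_one_pow_eq_or ℂ s₂ with h' | h' <;>
    rw [h, h'] <;> norm_num

theorem neg_two_zpow_mul_zpow (r₁ r₂ : ℕ) :
    (-2 : ℂ) ^ ((r₂ : ℤ) - (r₁ : ℤ)) * (-2) ^ ((r₁ : ℤ) - (r₂ : ℤ)) = 1 := by
  rw [← zpow_add₀ (by norm_num)]
  simp

/-- The difference of the indicator and the single integral, rescaled. -/
theorem indicator_sub_single_integral (l : ℝ) (r₁ r₂ s₁ s₂ : ℕ) (a₁ a₂ : HalfSign)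
    (hl : 0 < l) (hs₁ : 0 < s₁) :
    (-2 : ℂ) ^ ((r₂ : ℤ) - (r₁ : ℤ)) * (-1 : ℂ) ^ ((s₁ : ℤ) - (s₂ : ℤ)) * ((l⁻¹ : ℝ) : ℂ) *
      ((if r₁ = r₂ ∧ a₁ = a₂ ∧ s₁ = s₂ then 1 else 0) -
        (if 2 * (r₁ : ℝ) + a₁.val ≥ 2 * (r₂ : ℝ) + a₂.val then
          W a₁ s₁ / (Real.pi : ℂ) *
            ∫ x in (-1 : ℝ)..1, (jacobi a₁ s₁).eval (x : ℂ) * (jacobi a₂ s₂).eval (x : ℂ) *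
              ((x : ℂ) - 1) ^ ((r₁ : ℤ) - (r₂ : ℤ)) * weight a₁ x
        else 0)) =
    ((if 0 < 2 * r₁ + a₁.shift - (2 * r₂ + a₂.shift) then
      -((cosIntegral (2 * r₁ + a₁.shift - (2 * r₂ + a₂.shift))
            ((2 * s₁ + a₁.shift : ℕ) + (2 * s₂ + a₂.shift : ℕ)) / (l / 2) +
          cosIntegral (2 * r₁ + a₁.shift - (2 * r₂ + a₂.shift))
            ((2 * s₁ + a₁.shift : ℕ) - (2 * s₂ + a₂.shift : ℕ)) / (l / 2)) / Real.pi)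
      else 0 : ℝ) : ℂ) := by
  have hb₁ := a₁.shift_le_one
  have hb₂ := a₂.shift_le_one
  have hsign := neg_one_zpow_mul_pow s₁ s₂
  have hpow := neg_two_zpow_mul_zpow r₁ r₂
  have hW := W_mul_two_pow a₁ hs₁
  have hpi : (Real.pi : ℂ) ≠ 0 := by exact_mod_cast Real.pi_ne_zero
  have hlC : (l : ℂ) ≠ 0 := by exact_mod_cast hl.ne'
  by_cases hle : 2 * r₂ + a₂.shift ≤ 2 * r₁ + a₁.shift
  · rw [if_pos ((level_le_iff _ _ _ _).2 hle)]
    obtain ⟨m, hm⟩ := Nat.exists_eq_add_of_le hle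
    rw [single_integral_eq r₁ r₂ s₁ s₂ m a₁ a₂ hm, hm, Nat.add_sub_cancel_left]
    set C := cosIntegral m ((2 * s₁ + a₁.shift : ℕ) + (2 * s₂ + a₂.shift : ℕ))
    set D := cosIntegral m ((2 * s₁ + a₁.shift : ℕ) - (2 * s₂ + a₂.shift : ℕ))
    have hfirst : (-2 : ℂ) ^ ((r₂ : ℤ) - (r₁ : ℤ)) * (-1 : ℂ) ^ ((s₁ : ℤ) - (s₂ : ℤ)) *
        ((l⁻¹ : ℝ) : ℂ) * (W a₁ s₁ / (Real.pi : ℂ) * ((-2 : ℂ) ^ ((r₁ : ℤ) - (r₂ : ℤ)) *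
          (-1 : ℂ) ^ (s₁ + s₂) * 2 ^ a₁.shift * ((C + D : ℝ) : ℂ))) =
        (((C + D) / (l / 2) / Real.pi : ℝ) : ℂ) := by
      push_cast
      calc _ = ((-2 : ℂ) ^ ((r₂ : ℤ) - (r₁ : ℤ)) * (-2) ^ ((r₁ : ℤ) - (r₂ : ℤ))) *
            ((-1 : ℂ) ^ ((s₁ : ℤ) - (s₂ : ℤ)) * (-1) ^ (s₁ + s₂)) * (W a₁ s₁ * 2 ^ a₁.shift) *
            ((C + D) / (l * Real.pi)) := by field_simp
        _ = _ := by rw [hsign, hpow, hW]; field_simp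
    rw [mul_sub, hfirst]
    rcases Nat.eq_zero_or_pos m with h0 | h0
    -- Equal levels force equal `r` and equal `a`, since the shifts are `0` or `1`. Both frequencies
    -- are then even integers, the sum being nonzero because `s₁ > 0`, and orthogonality reproduces
    -- the indicator exactly.
    · subst h0
      have hr : r₁ = r₂ := by omega
      have ha : a₁ = a₂ := HalfSign.shift_injective (by omega)
      subst hr ha
      have hC : C = 0 := by
        have : C = cosIntegral 0 (2 * ((s₁ + s₂ + a₁.shift : ℕ) : ℤ)) := by
          simp only [C]; congr 1; push_cast; ring
        rw [this]
        exact cosIntegral_zero_of_int (by positivity)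
      rw [if_neg (lt_irrefl 0), hC]
      by_cases hs : s₁ = s₂
      · subst hs
        have hD : D = Real.pi / 2 := by
          simp only [D, sub_self]
          exact cosIntegral_zero_zero
        rw [hD]
        simp
        field_simp
        norm_num
      · have hD : D = 0 := by
          have : D = cosIntegral 0 (2 * ((s₁ : ℤ) - (s₂ : ℤ) : ℤ)) := by
            simp only [D]; congr 1; push_cast; ring
          rw [this]
          exact cosIntegral_zero_of_int (by omega)
        rw [hD]
        simp [hs]
    · have hne : ¬ (r₁ = r₂ ∧ a₁ = a₂ ∧ s₁ = s₂) := by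
        rintro ⟨rfl, rfl, -⟩
        omega
      rw [if_neg hne, if_pos h0]
      push_cast
      ring
  · rw [if_neg (fun h => hle ((level_le_iff _ _ _ _).1 h)),
      if_neg (show ¬ 0 < 2 * r₁ + a₁.shift - (2 * r₂ + a₂.shift) by omega)]
    have hne : ¬ (r₁ = r₂ ∧ a₁ = a₂ ∧ s₁ = s₂) := by
      rintro ⟨rfl, rfl, -⟩
      exact hle le_rfl
    rw [if_neg hne]
    simp

theorem natCast_sub_eq_max (a b : ℕ) : ((a - b : ℕ) : ℝ) = max ((a : ℝ) - b) 0 := by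
  rcases le_total b a with h | h
  · rw [Nat.cast_sub h, max_eq_left (sub_nonneg.2 (by exact_mod_cast h))]
  · rw [Nat.sub_eq_zero_of_le h, max_eq_right (sub_nonpos.2 (by exact_mod_cast h)), Nat.cast_zero]

theorem tendsto_level_sub {ρ η₁ η₂ : ℝ} {l : ℕ → ℝ} {n r₁ r₂ : ℕ → ℕ} (e₁ e₂ : ℕ)
    (H₁ : IsScaling ρ η₁ l n r₁) (H₂ : IsScaling ρ η₂ l n r₂) :
    Tendsto (fun N => (((2 * r₁ N + e₁ : ℕ) : ℝ) - (2 * r₂ N + e₂ : ℕ)) * (l N / 2) ^ 2) atTop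
      (𝓝 (2 * (η₁ - η₂))) := by
  have h := (((H₁.level.sub H₂.level).const_mul 2).add
    ((H₁.tendsto_zero.pow 2).const_mul ((e₁ : ℝ) - e₂))).div_const 4
  have e : (2 * (4 * η₁ - 4 * η₂) + ((e₁ : ℝ) - e₂) * 0 ^ 2) / 4 = 2 * (η₁ - η₂) := by ring
  rw [e] at h
  exact h.congr fun N => by push_cast; ring

/-- The limit of the part of the rescaled kernel that is a single integral. -/
theorem tendsto_single_part {ρ σ₁ σ₂ η₁ η₂ : ℝ} {l : ℕ → ℝ} {n r₁ r₂ k₁ k₂ : ℕ → ℕ} (e₁ e₂ : ℕ)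
    (H₁ : IsScaling ρ η₁ l n r₁) (H₂ : IsScaling ρ η₂ l n r₂) (hσ₁ : 0 < σ₁) (hσ₂ : 0 < σ₂)
    (hk₁ : Tendsto (fun N => (k₁ N : ℝ) * (l N / 2)) atTop (𝓝 σ₁))
    (hk₂ : Tendsto (fun N => (k₂ N : ℝ) * (l N / 2)) atTop (𝓝 σ₂))
    (hne : (σ₁, η₁) ≠ (σ₂, η₂) ∨ ∀ᶠ N in atTop, 2 * r₁ N + e₁ ≤ 2 * r₂ N + e₂) :
    Tendsto (fun N => if 0 < 2 * r₁ N + e₁ - (2 * r₂ N + e₂) then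
      -((cosIntegral (2 * r₁ N + e₁ - (2 * r₂ N + e₂)) ((k₁ N : ℝ) + k₂ N) / (l N / 2) +
          cosIntegral (2 * r₁ N + e₁ - (2 * r₂ N + e₂)) ((k₁ N : ℝ) - k₂ N) / (l N / 2)) / Real.pi)
      else 0) atTop
      (𝓝 (-(if η₂ < η₁ then (1 / (2 * Real.sqrt (Real.pi * (η₁ - η₂))) *
      (Real.exp ((σ₁ + σ₂) ^ 2 / (4 * (η₂ - η₁))) +
        Real.exp ((σ₁ - σ₂) ^ 2 / (4 * (η₂ - η₁))))) else 0))) := by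
  have hM := tendsto_level_sub e₁ e₂ H₁ H₂
  have hμ : ∀ᶠ N in atTop, 0 < l N / 2 := H₁.pos.mono fun N hN => by positivity
  have hμ0 : Tendsto (fun N => l N / 2) atTop (𝓝 0) := by
    simpa using H₁.tendsto_zero.div_const 2
  have hm : Tendsto (fun N => ((2 * r₁ N + e₁ - (2 * r₂ N + e₂) : ℕ) : ℝ) * (l N / 2) ^ 2) atTop
      (𝓝 (max (2 * (η₁ - η₂)) 0)) := by
    refine (hM.max tendsto_const_nhds).congr fun N => ?_
    rw [natCast_sub_eq_max, max_mul_of_nonneg _ _ (sq_nonneg _), zero_mul]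
  have hp : Tendsto (fun N => ((k₁ N : ℝ) + k₂ N) * (l N / 2)) atTop (𝓝 (σ₁ + σ₂)) :=
    (hk₁.add hk₂).congr fun N => by ring
  have hd : Tendsto (fun N => ((k₁ N : ℝ) - k₂ N) * (l N / 2)) atTop (𝓝 (σ₁ - σ₂)) :=
    (hk₁.sub hk₂).congr fun N => by ring
  have hzero : (∀ᶠ N in atTop, 2 * r₁ N + e₁ ≤ 2 * r₂ N + e₂) → Tendsto (fun N =>
      if 0 < 2 * r₁ N + e₁ - (2 * r₂ N + e₂) then
      -((cosIntegral (2 * r₁ N + e₁ - (2 * r₂ N + e₂)) ((k₁ N : ℝ) + k₂ N) / (l N / 2) +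
          cosIntegral (2 * r₁ N + e₁ - (2 * r₂ N + e₂)) ((k₁ N : ℝ) - k₂ N) / (l N / 2)) / Real.pi)
      else 0) atTop (𝓝 0) := by
    intro h
    refine tendsto_const_nhds.congr' (h.mono fun N hN => ?_)
    exact (if_neg (by omega)).symm
  -- The level difference has size `2(η₁-η₂)/(l/2)²`: eventually negative, of unknown sign and lower
  -- order, or in the Gaussian regime.
  rcases lt_trichotomy η₁ η₂ with h | h | h
  · rw [if_neg h.not_gt, neg_zero]
    refine hzero ?_
    filter_upwards [hM.eventually_lt_const (by linarith : 2 * (η₁ - η₂) < 0), hμ] with N hN hl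
    by_contra hcon
    have : (0 : ℝ) ≤ ((2 * r₁ N + e₁ : ℕ) : ℝ) - (2 * r₂ N + e₂ : ℕ) :=
      sub_nonneg.2 (by exact_mod_cast (not_le.1 hcon).le)
    have := mul_nonneg this (sq_nonneg (l N / 2))
    linarith
  · subst h
    rw [if_neg (lt_irrefl _), neg_zero]
    rcases hne with hne | hne
    swap
    · exact hzero hne
    -- With `η₁ = η₂`, distinct limit points mean `σ₁ ≠ σ₂`, so the difference frequency is also of
    -- order `1/l`.
    have hσ : σ₁ - σ₂ ≠ 0 := fun h0 => hne (by rw [sub_eq_zero.1 h0])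
    rw [sub_self, mul_zero, max_self] at hm
    obtain ⟨B, hB, hB'⟩ := tendsto_cosIntegral_bound (add_pos hσ₁ hσ₂).ne' hm hp hμ
    obtain ⟨B₂, hB₂, hB₂'⟩ := tendsto_cosIntegral_bound hσ hm hd hμ
    have hBB : Tendsto (fun N => (|B N| + |B₂ N|) / Real.pi) atTop (𝓝 0) := by
      simpa using (hB.abs.add hB₂.abs).div_const Real.pi
    refine squeeze_zero_norm' ?_ hBB
    filter_upwards [hB', hB₂'] with N h1 h2
    split_ifs with h0
    · rw [norm_neg, Real.norm_eq_abs, abs_div, abs_of_pos Real.pi_pos]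
      gcongr
      refine (abs_add_le _ _).trans ?_
      linarith [h1 h0, h2 h0, le_abs_self (B N), le_abs_self (B₂ N)]
    · rw [norm_zero]
      positivity
  · rw [if_pos h]
    have hd0 : 0 < η₁ - η₂ := sub_pos.2 h
    rw [max_eq_left (by linarith)] at hm
    have l1 := tendsto_cosIntegral_gaussian hμ hμ0 hd0 hm hp
    have l2 := tendsto_cosIntegral_gaussian hμ hμ0 hd0 hm hd
    have hl := ((l1.add l2).div_const Real.pi).neg
    have hsq : Real.sqrt (Real.pi / (η₁ - η₂)) / 2 / Real.pi =
        1 / (2 * Real.sqrt (Real.pi * (η₁ - η₂))) := by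
      have hπ := Real.pi_pos
      have e1 : Real.sqrt Real.pi ^ 2 = Real.pi := Real.sq_sqrt hπ.le
      have e2 : 0 < Real.sqrt (η₁ - η₂) := Real.sqrt_pos.2 hd0
      have e3 : 0 < Real.sqrt Real.pi := Real.sqrt_pos.2 hπ
      rw [Real.sqrt_div hπ.le, Real.sqrt_mul hπ.le, div_div, div_div, div_eq_div_iff
        (by positivity) (by positivity)]
      linear_combination (2 * Real.sqrt (η₁ - η₂)) * e1
    have hex : ∀ a : ℝ, -a ^ 2 / (4 * (η₁ - η₂)) = a ^ 2 / (4 * (η₂ - η₁)) := by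
      intro a
      rw [← neg_sub η₁ η₂, mul_neg, div_neg, neg_div]
    have hval : (Real.sqrt (Real.pi / (η₁ - η₂)) / 2 * Real.exp (-(σ₁ + σ₂) ^ 2 / (4 * (η₁ - η₂))) +
        Real.sqrt (Real.pi / (η₁ - η₂)) / 2 * Real.exp (-(σ₁ - σ₂) ^ 2 / (4 *
            (η₁ - η₂)))) / Real.pi =
        1 / (2 * Real.sqrt (Real.pi * (η₁ - η₂))) * (Real.exp ((σ₁ + σ₂) ^ 2 / (4 * (η₂ - η₁))) +
        Real.exp ((σ₁ - σ₂) ^ 2 / (4 * (η₂ - η₁)))) := by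
      rw [← hsq, hex, hex]
      ring
    rw [hval] at hl
    refine hl.congr' ?_
    filter_upwards [hm.eventually_const_lt (by linarith : 0 < 2 * (η₁ - η₂))] with N hN
    have : 0 < 2 * r₁ N + e₁ - (2 * r₂ N + e₂) := by
      by_contra h0
      rw [Nat.eq_zero_of_not_pos h0] at hN
      simp at hN
    rw [if_pos this]

/-! ### Normalising constants and the final limit -/

/-- The double integral part of the rescaled kernel. -/
theorem scaled_double_integral_eq (α : ℝ) (hα : 0 < α) (l : ℝ) (hl : 0 < l)
    (n r₁ r₂ s₁ s₂ : ℕ) (a₁ a₂ : HalfSign) (hs₁ : 0 < s₁) :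
    (-2 : ℂ) ^ ((r₂ : ℤ) - (r₁ : ℤ)) * (-1 : ℂ) ^ ((s₁ : ℤ) - (s₂ : ℤ)) * ((l⁻¹ : ℝ) : ℂ) *
      (W a₁ s₁ / (Real.pi : ℂ) * (1 / (2 * (Real.pi : ℂ) * Complex.I)) *
        ∫ x in (-1 : ℝ)..1, ∮ u in C(0, 2), phi α (x : ℂ) ^ n / phi α u ^ n *
          (jacobi a₁ s₁).eval (x : ℂ) * (jacobi a₂ s₂).eval u *
          (((x : ℂ) - 1) ^ r₁ / (u - 1) ^ r₂) * (weight a₁ x / ((x : ℂ) - u))) =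
    -(1 / (2 * (Real.pi : ℂ) ^ 2)) * ∫ ξ in Ioo 0 (Real.pi / l), ∑ b : Bool,
      ∫ t in Ioo 0 (2 * Real.sqrt Real.pi / l),
        scaledIntegrand (1 - ((1 + α) ^ 2)⁻¹) l n r₁ r₂ a₁.shift a₂.shift (2 * s₁ + a₁.shift)
          (2 * s₂ + a₂.shift) b ξ t := by
  rw [double_integral_eq α hα _ rfl l hl]
  simp only [scaledIntegrand]
  have hpi : (Real.pi : ℂ) ≠ 0 := by exact_mod_cast Real.pi_ne_zero
  have hlC : (l : ℂ) ≠ 0 := by exact_mod_cast hl.ne'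
  generalize (∫ ξ in Ioo 0 (Real.pi / l), ∑ b : Bool, _ : ℂ) = X
  push_cast
  calc _ = ((-2 : ℂ) ^ ((r₂ : ℤ) - (r₁ : ℤ)) * (-2) ^ ((r₁ : ℤ) - (r₂ : ℤ))) *
        ((-1 : ℂ) ^ ((s₁ : ℤ) - (s₂ : ℤ)) * (-1) ^ (s₁ + s₂)) * (W a₁ s₁ * 2 ^ a₁.shift) *
        (-Complex.I / 2 * X / (Real.pi * (2 * Real.pi * Complex.I))) := by
        field_simp
    _ = _ := by
        rw [neg_one_zpow_mul_pow, neg_two_zpow_mul_zpow, W_mul_two_pow a₁ hs₁]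
        field_simp [Complex.I_ne_zero]

theorem cAlpha_pos {α : ℝ} (hα : 0 < α) : 0 < cAlpha α := by
  unfold cAlpha
  positivity

/-- Since `ρ(1-ρ) = α(2+α)/(1+α)⁴`, the constant `c_α` is exactly what makes the quartic coefficient
independent of `α`. -/
theorem cAlpha_pow_four {α : ℝ} (hα : 0 < α) :
    cAlpha α ^ 4 * ((1 - ((1 + α) ^ 2)⁻¹) * (1 - (1 - ((1 + α) ^ 2)⁻¹))) = 1 := by
  have h : ((α * (2 + α)) ^ (-(1 / 4) : ℝ)) ^ 4 = (α * (2 + α))⁻¹ := by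
    rw [← Real.rpow_natCast, ← Real.rpow_mul (by positivity)]
    norm_num [Real.rpow_neg_one]
  rw [cAlpha, mul_pow, h]
  field_simp
  ring

/-- The constants `32` and `4` of the scaling are `(2^(5/4))⁴` and `2^(-1/2) · (2^(5/4))²`. -/
theorem isScaling_of_tendsto {α : ℝ} (hα : 0 < α) {η : ℝ} {n r : ℕ → ℕ}
    (hn : Tendsto (fun N : ℕ => (n N : ℝ) / (N : ℝ)) atTop (𝓝 1))
    (hr : Tendsto (fun N : ℕ => ((r N : ℝ) - (1 - ((1 + α) ^ 2)⁻¹) * (n N : ℝ)) / Real.sqrt N)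
      atTop (𝓝 ((2 : ℝ) ^ (-(1 / 2) : ℝ) * η * (cAlpha α ^ 2)⁻¹))) :
    IsScaling (1 - ((1 + α) ^ 2)⁻¹) η
      (fun N : ℕ => cAlpha α * (2 : ℝ) ^ (5 / 4 : ℝ) / (N : ℝ) ^ (1 / 4 : ℝ)) n r := by
  have hc := cAlpha_pos hα
  have hpow : ∀ N : ℕ, ((N : ℝ) ^ (1 / 4 : ℝ)) ^ 4 = N := fun N => by
    rw [← Real.rpow_natCast, ← Real.rpow_mul (by positivity)]; norm_num
  have hpow2 : ∀ N : ℕ, ((N : ℝ) ^ (1 / 4 : ℝ)) ^ 2 = Real.sqrt N := fun N => by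
    rw [← Real.rpow_natCast, ← Real.rpow_mul (by positivity), Real.sqrt_eq_rpow]; norm_num
  have h24 : ((2 : ℝ) ^ (5 / 4 : ℝ)) ^ 4 = 32 := by
    rw [← Real.rpow_natCast, ← Real.rpow_mul (by positivity)]; norm_num
  have h22 : (2 : ℝ) ^ (-(1 / 2) : ℝ) * ((2 : ℝ) ^ (5 / 4 : ℝ)) ^ 2 = 4 := by
    rw [← Real.rpow_natCast, ← Real.rpow_mul (by positivity), ← Real.rpow_add two_pos]; norm_num
  have hq1 : (1 + α) ^ 2 > 1 := by nlinarith
  have hq2 : ((1 + α) ^ 2)⁻¹ < 1 := inv_lt_one_of_one_lt₀ hq1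
  have hq3 : 0 < ((1 + α) ^ 2)⁻¹ := by positivity
  refine ⟨by linarith, by linarith, ?_, ?_, ?_, ?_⟩
  · filter_upwards [eventually_gt_atTop 0] with N hN
    have : (0 : ℝ) < N := by exact_mod_cast hN
    positivity
  · have h1 : Tendsto (fun N : ℕ => (N : ℝ) ^ (1 / 4 : ℝ)) atTop atTop :=
      (tendsto_rpow_atTop (by norm_num)).comp tendsto_natCast_atTop_atTop
    exact tendsto_const_nhds.div_atTop h1
  · have := hn.mul_const 32
    rw [one_mul] at this
    refine this.congr fun N => ?_
    rw [div_pow, mul_pow, h24, hpow]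
    linear_combination (-(n N / N * 32 : ℝ)) * cAlpha_pow_four hα
  · have := hr.mul_const (cAlpha α ^ 2 * ((2 : ℝ) ^ (5 / 4 : ℝ)) ^ 2)
    have e : (2 : ℝ) ^ (-(1 / 2) : ℝ) * η * (cAlpha α ^ 2)⁻¹ *
        (cAlpha α ^ 2 * ((2 : ℝ) ^ (5 / 4 : ℝ)) ^ 2) = 4 * η := by
      calc _ = (2 : ℝ) ^ (-(1 / 2) : ℝ) * ((2 : ℝ) ^ (5 / 4 : ℝ)) ^ 2 * η := by field_simp
        _ = _ := by rw [h22]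
    rw [e] at this
    refine this.congr fun N => ?_
    rw [div_pow, mul_pow, hpow2]
    ring

theorem tendsto_index_of_tendsto {α : ℝ} (hα : 0 < α) {σ : ℝ} {s : ℕ → ℕ} (e : ℕ)
    (hs : Tendsto (fun N : ℕ => (s N : ℝ) / (N : ℝ) ^ (1 / 4 : ℝ))
      atTop (𝓝 ((2 : ℝ) ^ (-(5 / 4) : ℝ) * σ * (cAlpha α)⁻¹)))
    (hl : Tendsto (fun N : ℕ => cAlpha α * (2 : ℝ) ^ (5 / 4 : ℝ) / (N : ℝ) ^ (1 / 4 : ℝ)) atTop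
      (𝓝 0)) :
    Tendsto (fun N => ((2 * s N + e : ℕ) : ℝ) *
      (cAlpha α * (2 : ℝ) ^ (5 / 4 : ℝ) / (N : ℝ) ^ (1 / 4 : ℝ) / 2)) atTop (𝓝 σ) := by
  have hc := cAlpha_pos hα
  have h := (hs.mul_const (cAlpha α * (2 : ℝ) ^ (5 / 4 : ℝ))).add (hl.const_mul ((e : ℝ) / 2))
  have h2 : (2 : ℝ) ^ (-(5 / 4) : ℝ) * (2 : ℝ) ^ (5 / 4 : ℝ) = 1 := by
    rw [← Real.rpow_add two_pos]; norm_num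
  have ev : (2 : ℝ) ^ (-(5 / 4) : ℝ) * σ * (cAlpha α)⁻¹ * (cAlpha α * (2 : ℝ) ^ (5 / 4 : ℝ)) +
      (e : ℝ) / 2 * 0 = σ := by
    calc _ = ((2 : ℝ) ^ (-(5 / 4) : ℝ) * (2 : ℝ) ^ (5 / 4 : ℝ)) * σ := by field_simp; ring
      _ = σ := by rw [h2, one_mul]
  rw [ev] at h
  exact h.congr fun N => by push_cast; ring

theorem eventually_pos_of_tendsto {α : ℝ} (hα : 0 < α) {σ : ℝ} (hσ : 0 < σ) {s : ℕ → ℕ}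
    (hs : Tendsto (fun N : ℕ => (s N : ℝ) / (N : ℝ) ^ (1 / 4 : ℝ))
      atTop (𝓝 ((2 : ℝ) ^ (-(5 / 4) : ℝ) * σ * (cAlpha α)⁻¹))) : ∀ᶠ N in atTop, 0 < s N := by
  have hc := cAlpha_pos hα
  filter_upwards [hs.eventually_const_lt
    (by positivity : 0 < (2 : ℝ) ^ (-(5 / 4) : ℝ) * σ * (cAlpha α)⁻¹)] with N hN
  rcases Nat.eq_zero_or_pos (s N) with h | h
  · simp [h] at hN
  · exact h

end SymmetricPearcey

end

open SymmetricPearcey in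
theorem mainTheorem3 (α : ℝ) (hα : 0 < α) (a₁ a₂ : HalfSign)
    (σ₁ σ₂ η₁ η₂ : ℝ) (hσ₁ : 0 < σ₁) (hσ₂ : 0 < σ₂)
    (n r₁ r₂ s₁ s₂ : ℕ → ℕ)
    (hn : Tendsto (fun N : ℕ => (n N : ℝ) / (N : ℝ)) atTop (𝓝 1))
    (hr₁ : Tendsto (fun N : ℕ => ((r₁ N : ℝ) - (1 - ((1 + α) ^ 2)⁻¹) * (n N : ℝ)) / Real.sqrt N)
      atTop (𝓝 ((2 : ℝ) ^ (-(1 / 2) : ℝ) * η₁ * (cAlpha α ^ 2)⁻¹)))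
    (hr₂ : Tendsto (fun N : ℕ => ((r₂ N : ℝ) - (1 - ((1 + α) ^ 2)⁻¹) * (n N : ℝ)) / Real.sqrt N)
      atTop (𝓝 ((2 : ℝ) ^ (-(1 / 2) : ℝ) * η₂ * (cAlpha α ^ 2)⁻¹)))
    (hs₁ : Tendsto (fun N : ℕ => (s₁ N : ℝ) / (N : ℝ) ^ (1 / 4 : ℝ))
      atTop (𝓝 ((2 : ℝ) ^ (-(5 / 4) : ℝ) * σ₁ * (cAlpha α)⁻¹)))
    (hs₂ : Tendsto (fun N : ℕ => (s₂ N : ℝ) / (N : ℝ) ^ (1 / 4 : ℝ))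
      atTop (𝓝 ((2 : ℝ) ^ (-(5 / 4) : ℝ) * σ₂ * (cAlpha α)⁻¹)))
    (hne : (σ₁, η₁) ≠ (σ₂, η₂) ∨
      ∀ᶠ N : ℕ in atTop, 2 * (r₁ N : ℝ) + a₁.val ≤ 2 * (r₂ N : ℝ) + a₂.val) :
    Tendsto
      (fun N : ℕ =>
        (-2 : ℂ) ^ ((r₂ N : ℤ) - (r₁ N : ℤ)) * (-1 : ℂ) ^ ((s₁ N : ℤ) - (s₂ N : ℤ)) *
          (((N : ℝ) ^ (1 / 4 : ℝ) / (cAlpha α * (2 : ℝ) ^ (5 / 4 : ℝ)) : ℝ) : ℂ) *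
          ((if r₁ N = r₂ N ∧ a₁ = a₂ ∧ s₁ N = s₂ N then 1 else 0) -
            kernelK α (n N) (r₁ N) a₁ (s₁ N) (r₂ N) a₂ (s₂ N)))
      atTop (𝓝 (pearceyKernel σ₁ η₁ σ₂ η₂)) := by
  have H₁ := isScaling_of_tendsto hα hn hr₁
  have H₂ := isScaling_of_tendsto hα hn hr₂
  have hk₁ := tendsto_index_of_tendsto hα a₁.shift hs₁ H₁.tendsto_zero
  have hk₂ := tendsto_index_of_tendsto hα a₂.shift hs₂ H₁.tendsto_zero
  have hne' : (σ₁, η₁) ≠ (σ₂, η₂) ∨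
      ∀ᶠ N in atTop, 2 * r₁ N + a₁.shift ≤ 2 * r₂ N + a₂.shift :=
    hne.imp_right fun h => h.mono fun N hN => (level_le_iff _ _ _ _).1 hN
  have hsingle := (Complex.continuous_ofReal.tendsto _).comp
    (tendsto_single_part a₁.shift a₂.shift H₁ H₂ hσ₁ hσ₂ hk₁ hk₂ hne')
  have hdouble := (tendsto_double_integral a₁.shift a₂.shift H₁ H₂ hk₁ hk₂).const_mul
    (-(1 / (2 * (Real.pi : ℂ) ^ 2)))
  rw [sum_limitIntegrand_eq] at hdouble
  have hlim := hsingle.sub hdouble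
  have hpi : (Real.pi : ℂ) ≠ 0 := by exact_mod_cast Real.pi_ne_zero
  -- Only `1/i = -i` is used to match the prefactor of the Pearcey integral.
  have hval : ∀ X R : ℂ, -X - -(1 / (2 * (Real.pi : ℂ) ^ 2)) * (-4 * Complex.I * R) =
      2 / ((Real.pi : ℂ) ^ 2 * Complex.I) * R - X := by
    intro X R
    field_simp [Complex.I_ne_zero]
    linear_combination (-4 * R) * Complex.I_sq
  rw [Complex.ofReal_neg, hval] at hlim
  rw [pearceyKernel]
  convert hlim.congr' ?_ using 2
  · split_ifs <;> simp
  · filter_upwards [H₁.pos, eventually_pos_of_tendsto hα hσ₁ hs₁] with N hl h1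
    have e1 := indicator_sub_single_integral _ (r₁ N) (r₂ N) (s₁ N) (s₂ N) a₁ a₂ hl h1
    have e2 := scaled_double_integral_eq α hα _ hl (n N) (r₁ N) (r₂ N) (s₁ N) (s₂ N) a₁ a₂ h1
    rw [inv_div] at e1 e2
    rw [kernelK, ← sub_sub, mul_sub, e1, e2]
    rfl
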